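/- Let $n\ge 1$, $s\ge 0$ and $\sigma\in(1,2]$, and let $(u,\theta)$ be the solution of the Cauchy problem for the thermoelastic plate equations with structural damping in $\mathbb{R}^n$, $$u_{tt}+\Delta^2u+\Delta\theta+(-\Delta)^{\sigma}u_t=0,\qquad \theta_t-\Delta\theta-\Delta u_t=0,\qquad (u,u_t,\theta)(0,\cdot)=(u_0,u_1,\theta_0),$$ understood in the sense of tempered distributions in $x$, in the class $|D|^2u,\,u_t,\,\theta\in C([0,\infty);L^2(\mathbb{R}^n))$, where $|D|^2=-\Delta$. Put $$U=(u_t+|D|^2u,\;u_t-|D|^2u,\;\theta)^{T},\qquad U_0=(u_1+|D|^2u_0,\;u_1-|D|^2u_0,\;\theta_0)^{T},\qquad P_{U_0}=\int_{\mathbb{R}^n}U_0(x)\,dx\in\mathbb{C}^3,$$ and let $\|f\|_{L^{1,1}}=\int_{\mathbb{R}^n}(1+|x|)|f(x)|\,dx$, $\|f\|_{H^s\cap L^{1,1}}=\|f\|_{H^s}+\|f\|_{L^{1,1}}$ (with the corresponding norms for vector-valued functions). Then there are constants $c,C,t_0>0$, depending only on $n$, $s$ and $\sigma$, such that for all data with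 $U_0\in H^s(\mathbb{R}^n)\cap L^{1,1}(\mathbb{R}^n)$ and $P_{U_0}\ne 0$ one has $$\|U(t,\cdot)\|_{\dot H^s(\mathbb{R}^n)}\le C\,t^{-\frac{n+2s}{4}}\,\|U_0\|_{H^s\cap L^{1,1}}\qquad\text{for all } t\ge t_0,$$ and there is $T\ge t_0$, which may depend on the data, such that $$c\,t^{-\frac{n+2s}{4}}\,|P_{U_0}|\le\|U(t,\cdot)\|_{\dot H^s(\mathbb{R}^n)}\qquad\text{for all } t\ge T.$$ -/

import Mathlib

open MeasureTheory
open scoped SchwartzMap FourierTransform Laplacian ENNReal Real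

noncomputable section

/-- Complex-valued `L²` functions on `ℝⁿ`. -/
abbrev L2 (n : ℕ) : Type := Lp (α := EuclideanSpace ℝ (Fin n)) ℂ 2

/-- The `L²` function `f` regarded as a tempered distribution. -/
abbrev L2.dist {n : ℕ} (f : L2 n) : 𝓢'(EuclideanSpace ℝ (Fin n), ℂ) :=
  Lp.toTemperedDistribution f

/-- The pairing `⟨(-Δ)^σ f, φ⟩` of the tempered distribution `(-Δ)^σ f` (for `f ∈ L²`, `σ ≥ 0`)
with a test function `φ`. Since `𝓕 f ξ = ∫ exp (-2πi x·ξ) f x`, the symbol of `-Δ` is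
`(2π|ξ|)²` and that of `(-Δ)^σ` is `(2π|ξ|)^(2σ)`; moreover `⟨T, φ⟩ = ⟨𝓕 T, 𝓕⁻ φ⟩`. -/
def fracLaplacePairing {n : ℕ} (σ : ℝ) (f : L2 n) (φ : 𝓢(EuclideanSpace ℝ (Fin n), ℂ)) : ℂ :=
  ∫ ξ : EuclideanSpace ℝ (Fin n),
    (((2 * π * ‖ξ‖) ^ (2 * σ) : ℝ) : ℂ) * (𝓕 f : L2 n) ξ
      * (𝓕⁻ φ : 𝓢(EuclideanSpace ℝ (Fin n), ℂ)) ξ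

/-- `(u, θ)` solves the Cauchy problem
`u_tt + Δ²u + Δθ + (-Δ)^σ u_t = 0`, `θ_t - Δθ - Δu_t = 0`, `(u, u_t, θ)(0) = (u₀, u₁, θ₀)`
on `[0, ∞) × ℝⁿ` in the sense of tempered distributions in `x`, in the class
`|D|²u, u_t, θ ∈ C([0, ∞); L²)`. Here `u t` is a tempered distribution, and the `L²` functions
`ut t` and `w t` represent `u_t(t)` and `|D|²u(t) = -Δu(t)`. -/
structure IsThermoPlateSolution {n : ℕ} (σ : ℝ)
    (u₀ : 𝓢'(EuclideanSpace ℝ (Fin n), ℂ)) (u₁ θ₀ : L2 n)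
    (u : ℝ → 𝓢'(EuclideanSpace ℝ (Fin n), ℂ)) (w ut θ : ℝ → L2 n) : Prop where
  w_eq : ∀ t, 0 ≤ t → (w t).dist = -Δ (u t)
  w_cont : ContinuousOn w (Set.Ici 0)
  ut_cont : ContinuousOn ut (Set.Ici 0)
  θ_cont : ContinuousOn θ (Set.Ici 0)
  u_cont : ∀ φ : 𝓢(EuclideanSpace ℝ (Fin n), ℂ), ContinuousOn (fun t => u t φ) (Set.Ici 0)
  /-- `ut` is the time derivative of `u`. -/
  u_deriv : ∀ φ : 𝓢(EuclideanSpace ℝ (Fin n), ℂ), ∀ t, 0 < t →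
    HasDerivAt (fun τ => u τ φ) ((ut t).dist φ) t
  /-- The plate equation `u_tt = -Δ²u - Δθ - (-Δ)^σ u_t`. -/
  plate : ∀ φ : 𝓢(EuclideanSpace ℝ (Fin n), ℂ), ∀ t, 0 < t →
    HasDerivAt (fun τ => (ut τ).dist φ)
      (-(Δ (Δ (u t))) φ - (Δ (θ t).dist) φ - fracLaplacePairing σ (ut t) φ) t
  /-- The heat equation `θ_t = Δθ + Δu_t`. -/
  heat : ∀ φ : 𝓢(EuclideanSpace ℝ (Fin n), ℂ), ∀ t, 0 < t →
    HasDerivAt (fun τ => (θ τ).dist φ) ((Δ (θ t).dist) φ + (Δ (ut t).dist) φ) t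
  u_init : u 0 = u₀
  ut_init : ut 0 = u₁
  θ_init : θ 0 = θ₀

/-- The vector `(v + w, v - w, θ)`; with `v = u_t` and `w = |D|²u` it is `U`. -/
def stateVector {n : ℕ} (w v θ : L2 n) : Fin 3 → L2 n := ![v + w, v - w, θ]

/-- The homogeneous Sobolev norm `‖U‖_{Ḣˢ} = ‖|D|ˢ U‖_{L²}` of a vector-valued `L²` function
(possibly `∞`). -/
def homSobolevNorm {n : ℕ} (s : ℝ) (U : Fin 3 → L2 n) : ℝ≥0∞ :=
  (∑ j, ∫⁻ ξ : EuclideanSpace ℝ (Fin n),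
    ENNReal.ofReal ((2 * π * ‖ξ‖) ^ (2 * s)) * ‖(𝓕 (U j) : L2 n) ξ‖ₑ ^ 2) ^ (1 / 2 : ℝ)

/-- The Sobolev norm `‖U‖_{Hˢ} = ‖⟨D⟩ˢ U‖_{L²}` of a vector-valued `L²` function
(possibly `∞`). -/
def sobolevNorm {n : ℕ} (s : ℝ) (U : Fin 3 → L2 n) : ℝ≥0∞ :=
  (∑ j, ∫⁻ ξ : EuclideanSpace ℝ (Fin n),
    ENNReal.ofReal ((1 + (2 * π * ‖ξ‖) ^ 2) ^ s) * ‖(𝓕 (U j) : L2 n) ξ‖ₑ ^ 2) ^ (1 / 2 : ℝ)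

/-- The weighted norm `‖U‖_{L^{1,1}} = ∑ j, ∫ (1 + |x|) |U j x| dx` (possibly `∞`). -/
def weightedL1Norm {n : ℕ} (U : Fin 3 → L2 n) : ℝ≥0∞ :=
  ∑ j, ∫⁻ x : EuclideanSpace ℝ (Fin n), ENNReal.ofReal (1 + ‖x‖) * ‖U j x‖ₑ

/-- The space `Hˢ ∩ L^{1,1}` of vector-valued functions. -/
def MemSobolevInterWeightedL1 {n : ℕ} (s : ℝ) (U : Fin 3 → L2 n) : Prop :=
  ∀ j, TemperedDistribution.MemSobolev s 2 (U j).dist ∧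
    Integrable (fun x : EuclideanSpace ℝ (Fin n) => (1 + ‖x‖) • U j x)

/-- The mean `P_U = ∫ U(x) dx ∈ ℂ³`. -/
def totalIntegral {n : ℕ} (U : Fin 3 → L2 n) : EuclideanSpace ℂ (Fin 3) :=
  WithLp.toLp 2 fun j => ∫ x : EuclideanSpace ℝ (Fin n), U j x

end

/-! With ρ = 2π|ξ|, p = ρ² and q = ρ^(2σ), the Fourier transforms z of (|D|²u, u_t, θ) satisfy the
linear system z' = Mz with M = `plateMatrix p q`. The plain energy obeys (|z|²)' = -2(q|z₁|² +
p|z₂|²), which misses z₀. Small multiples of the cross terms z₁z₂ and z₀z₁ give quadratic forms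
equivalent to |z|² that decay at a rate comparable to ρ² for ρ ≤ 1 (where q ≤ p) and at a fixed rate
for ρ ≥ 1 (where σ ≤ 2 enters). In the other direction, q ≤ p for ρ ≤ 1 shows that |z|² decays no
faster than exp(-2ρ²t), up to a loss in the exponent.

Upper bound: for ρ ≤ 1 the transform of U₀ is bounded by its L¹ norm, and ∫ ρ^(2s) exp(-cρ²t) dξ
scales like t^(-(n+2s)/2); frequencies ρ ≥ 1 contribute an exponentially small multiple of the
squared Hˢ norm. Lower bound: the transform of U₀ is continuous with value P_{U₀} at 0, so on the
shrinking ball ρ²t ≤ 1 the solution stays bounded below by a multiple of |P_{U₀}|, and that ball has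
the same scaling.

The solution is only a distributional one, so the pointwise differential inequality is not directly
available. `hasDerivAt_mulCLM_indicator` gives honest L²-valued derivatives after cutting off to
bounded frequency sets, `integral_hermForm_le_exp_mul` is Grönwall's argument for the integrated
form, and `hermForm_le_exp_mul` returns to almost every frequency by varying the set. -/

/-! ### The equations on the Fourier side, tested against Schwartz functions. -/

theorem L2.dist_apply {n : ℕ} (f : L2 n) (ψ : 𝓢(EuclideanSpace ℝ (Fin n), ℂ)) :
    f.dist ψ = ∫ ξ, ψ ξ * f ξ := by
  simp [L2.dist]

theorem L2.dist_injective {n : ℕ} : Function.Injective (L2.dist (n := n)) :=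
  LinearMap.ker_eq_bot.1
    (Lp.ker_toTemperedDistributionCLM_eq_bot (E := EuclideanSpace ℝ (Fin n)) (F := ℂ)
      (μ := volume) (p := 2))

theorem L2.dist_fourier {n : ℕ} (f : L2 n) (ψ : 𝓢(EuclideanSpace ℝ (Fin n), ℂ)) :
    f.dist (𝓕 ψ) = ∫ ξ, ψ ξ * (𝓕 f : L2 n) ξ := by
  rw [← TemperedDistribution.fourier_apply, Lp.fourier_toTemperedDistribution_eq]
  exact L2.dist_apply _ _

theorem L2.laplacian_dist_fourier {n : ℕ} (f : L2 n) (ψ : 𝓢(EuclideanSpace ℝ (Fin n), ℂ)) :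
    (Δ f.dist) (𝓕 ψ) = -∫ ξ, ψ ξ * (((2 * π * ‖ξ‖) ^ 2 : ℝ) : ℂ) * (𝓕 f : L2 n) ξ := by
  have hg : Function.HasTemperateGrowth
      (fun x : EuclideanSpace ℝ (Fin n) => Complex.ofReal (‖x‖ ^ 2)) := by fun_prop
  rw [TemperedDistribution.laplacian_eq_fourierMultiplierCLM]
  simp only [smul_apply,
    TemperedDistribution.fourierMultiplierCLM_apply_apply]
  rw [FourierTransform.fourierInv_fourier_eq, L2.dist_fourier]
  simp only [SchwartzMap.smulLeftCLM_apply_apply hg]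
  rw [← integral_smul, ← integral_neg]
  congr 1
  ext ξ
  simp only [smul_eq_mul, Complex.real_smul]
  push_cast
  ring

theorem fracLaplacePairing_fourier {n : ℕ} (σ : ℝ) (f : L2 n)
    (ψ : 𝓢(EuclideanSpace ℝ (Fin n), ℂ)) :
    fracLaplacePairing σ f (𝓕 ψ) =
      ∫ ξ, ψ ξ * (((2 * π * ‖ξ‖) ^ (2 * σ) : ℝ) : ℂ) * (𝓕 f : L2 n) ξ := by
  unfold fracLaplacePairing
  rw [FourierTransform.fourierInv_fourier_eq]
  congr 1
  ext ξ
  ring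

/-- Both sides define the same distribution: move the transform onto the test function, then test
with smooth compactly supported functions. -/
theorem L2.fourier_eq_integral {n : ℕ} (f : L2 n) (hf : Integrable f) :
    (𝓕 f : L2 n) =ᵐ[volume] 𝓕 (f : EuclideanSpace ℝ (Fin n) → ℂ) := by
  have hb : ∀ ξ, ‖𝓕 (f : EuclideanSpace ℝ (Fin n) → ℂ) ξ‖ ≤ ∫ x, ‖f x‖ := fun ξ =>
    VectorFourier.norm_fourierIntegral_le_integral_norm _ _ _ _ _
  have hc : Continuous (𝓕 (f : EuclideanSpace ℝ (Fin n) → ℂ)) :=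
    VectorFourier.fourierIntegral_continuous Real.continuous_fourierChar
      (by exact continuous_inner) hf
  have hw : ∀ ψ : 𝓢(EuclideanSpace ℝ (Fin n), ℂ),
      ∫ ξ, ψ ξ * (𝓕 f : L2 n) ξ = ∫ ξ, ψ ξ * 𝓕 (f : EuclideanSpace ℝ (Fin n) → ℂ) ξ := by
    intro ψ
    rw [← L2.dist_fourier, L2.dist_apply]
    have := VectorFourier.integral_fourierIntegral_smul_eq_flip (μ := volume) (ν := volume)
      (L := innerₗ (EuclideanSpace ℝ (Fin n))) Real.continuous_fourierChar
      (by exact continuous_inner) (ψ.integrable (μ := volume)) hf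
    simp only [flip_innerₗ, smul_eq_mul] at this
    exact this
  refine ae_eq_of_integral_contDiff_smul_eq ((Lp.memLp _).locallyIntegrable (by norm_num))
    hc.locallyIntegrable ?_
  intro g hg hgc
  have hg₁ : HasCompactSupport (Complex.ofRealCLM ∘ g) := hgc.comp_left rfl
  have hg₂ : ContDiff ℝ (⊤ : ℕ∞) (Complex.ofRealCLM ∘ g) := by fun_prop
  simpa using hw (hg₁.toSchwartzMap hg₂)

namespace IsThermoPlateSolution

variable {n : ℕ} {σ : ℝ} {u₀ : 𝓢'(EuclideanSpace ℝ (Fin n), ℂ)} {u₁ θ₀ : L2 n}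
  {u : ℝ → 𝓢'(EuclideanSpace ℝ (Fin n), ℂ)} {w ut θ : ℝ → L2 n}

theorem w_init (h : IsThermoPlateSolution σ u₀ u₁ θ₀ u w ut θ) {w₀ : L2 n}
    (hw : w₀.dist = -Δ u₀) : w 0 = w₀ :=
  L2.dist_injective (by rw [h.w_eq 0 le_rfl, h.u_init, hw])

theorem hasDerivAt_fourier_w (h : IsThermoPlateSolution σ u₀ u₁ θ₀ u w ut θ)
    (ψ : 𝓢(EuclideanSpace ℝ (Fin n), ℂ)) {t : ℝ} (ht : 0 < t) :
    HasDerivAt (fun τ => ∫ ξ, ψ ξ * (𝓕 (w τ) : L2 n) ξ)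
      (∫ ξ, ψ ξ * (((2 * π * ‖ξ‖) ^ 2 : ℝ) : ℂ) * (𝓕 (ut t) : L2 n) ξ) t := by
  have h1 := (h.u_deriv (Δ (𝓕 ψ)) t ht).neg
  rw [← TemperedDistribution.laplacian_apply_apply, L2.laplacian_dist_fourier, neg_neg] at h1
  refine h1.congr_of_eventuallyEq ?_
  filter_upwards [lt_mem_nhds ht] with τ hτ
  rw [← L2.dist_fourier, h.w_eq τ hτ.le]
  simp [TemperedDistribution.laplacian_apply_apply]

theorem hasDerivAt_fourier_ut (h : IsThermoPlateSolution σ u₀ u₁ θ₀ u w ut θ)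
    (ψ : 𝓢(EuclideanSpace ℝ (Fin n), ℂ)) {t : ℝ} (ht : 0 < t) :
    HasDerivAt (fun τ => ∫ ξ, ψ ξ * (𝓕 (ut τ) : L2 n) ξ)
      (-(∫ ξ, ψ ξ * (((2 * π * ‖ξ‖) ^ 2 : ℝ) : ℂ) * (𝓕 (w t) : L2 n) ξ)
        + (∫ ξ, ψ ξ * (((2 * π * ‖ξ‖) ^ 2 : ℝ) : ℂ) * (𝓕 (θ t) : L2 n) ξ)
        - ∫ ξ, ψ ξ * (((2 * π * ‖ξ‖) ^ (2 * σ) : ℝ) : ℂ) * (𝓕 (ut t) : L2 n) ξ) t := by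
  have h1 := h.plate (𝓕 ψ) t ht
  -- Writing -Δ²u as Δw leaves only L² functions, with multipliers p and q.
  have h2 : -(Δ (Δ (u t))) (𝓕 ψ) = (Δ (w t).dist) (𝓕 ψ) := by
    rw [TemperedDistribution.laplacian_apply_apply, TemperedDistribution.laplacian_apply_apply,
      h.w_eq t ht.le]
    simp
  rw [h2, L2.laplacian_dist_fourier, L2.laplacian_dist_fourier, fracLaplacePairing_fourier,
    sub_neg_eq_add] at h1
  simpa only [L2.dist_fourier] using h1

theorem hasDerivAt_fourier_θ (h : IsThermoPlateSolution σ u₀ u₁ θ₀ u w ut θ)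
    (ψ : 𝓢(EuclideanSpace ℝ (Fin n), ℂ)) {t : ℝ} (ht : 0 < t) :
    HasDerivAt (fun τ => ∫ ξ, ψ ξ * (𝓕 (θ τ) : L2 n) ξ)
      (-(∫ ξ, ψ ξ * (((2 * π * ‖ξ‖) ^ 2 : ℝ) : ℂ) * (𝓕 (θ t) : L2 n) ξ)
        - ∫ ξ, ψ ξ * (((2 * π * ‖ξ‖) ^ 2 : ℝ) : ℂ) * (𝓕 (ut t) : L2 n) ξ) t := by
  have h1 := h.heat (𝓕 ψ) t ht
  rw [L2.laplacian_dist_fourier, L2.laplacian_dist_fourier, ← sub_eq_add_neg] at h1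
  simpa only [L2.dist_fourier] using h1

end IsThermoPlateSolution

/-! ### Bounded multipliers on L². -/

section Multiplier

variable {α : Type*} [MeasurableSpace α] {μ : Measure α}

open Classical in
/-- Multiplication of `L²` functions by an essentially bounded real function `m`
(and `0` if `m` is not essentially bounded). -/
noncomputable def mulCLM (μ : Measure α) (m : α → ℝ) : Lp ℂ 2 μ →L[ℝ] Lp ℂ 2 μ :=
  if hm : MemLp m ∞ μ then
    (ContinuousLinearMap.lsmul ℝ ℝ : ℝ →L[ℝ] ℂ →L[ℝ] ℂ).holderL μ ∞ 2 2 (hm.toLp m)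
  else 0

theorem coeFn_mulCLM {m : α → ℝ} (hm : MemLp m ∞ μ) (f : Lp ℂ 2 μ) :
    mulCLM μ m f =ᵐ[μ] fun x => (m x : ℂ) * f x := by
  rw [mulCLM, dif_pos hm]
  filter_upwards [ContinuousLinearMap.coeFn_holder (r := 2)
    (ContinuousLinearMap.lsmul ℝ ℝ : ℝ →L[ℝ] ℂ →L[ℝ] ℂ) (hm.toLp m) f, hm.coeFn_toLp]
    with x h1 h2
  rw [ContinuousLinearMap.holderL_apply_apply, h1, h2]
  simp

theorem mulCLM_mulCLM {m₁ m₂ m₃ : α → ℝ} (h1 : MemLp m₁ ∞ μ) (h2 : MemLp m₂ ∞ μ)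
    (h3 : MemLp m₃ ∞ μ) (h : ∀ x, m₁ x * m₂ x = m₃ x) (f : Lp ℂ 2 μ) :
    mulCLM μ m₁ (mulCLM μ m₂ f) = mulCLM μ m₃ f := by
  apply Lp.ext
  filter_upwards [coeFn_mulCLM h1 (mulCLM μ m₂ f), coeFn_mulCLM h2 f, coeFn_mulCLM h3 f]
    with x e1 e2 e3
  rw [e1, e2, e3, ← h]
  push_cast
  ring

end Multiplier

/-! ### From tested derivatives to derivatives in L². -/

section WeakDerivative

variable {n : ℕ}

theorem L2.exists_dist_apply_eq (ψ : 𝓢(EuclideanSpace ℝ (Fin n), ℂ)) :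
    ∃ Λ : L2 n →L[ℂ] ℂ, ∀ f : L2 n, f.dist ψ = Λ f := by
  refine ⟨(ContinuousLinearMap.mul ℂ ℂ).lpPairing volume 2 2 (ψ.toLp 2), fun f => ?_⟩
  rw [ContinuousLinearMap.lpPairing_eq_integral, L2.dist_apply]
  refine integral_congr_ae ?_
  filter_upwards [ψ.coeFn_toLp 2 volume] with x hx
  simp [hx]

/-- Continuity of K makes ∫K a strong primitive. Tested against any ψ it has the same increments as
X, so the two increments agree in L². -/
theorem hasDerivAt_of_forall_dist {X K : ℝ → L2 n} (hK : ContinuousOn K (Set.Ioi 0))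
    (h : ∀ ψ : 𝓢(EuclideanSpace ℝ (Fin n), ℂ), ∀ t, 0 < t →
      HasDerivAt (fun τ => (X τ).dist ψ) ((K t).dist ψ) t) {t : ℝ} (ht : 0 < t) :
    HasDerivAt X (K t) t := by
  have hint : ∀ τ, 0 < τ → IntervalIntegrable K volume t τ := fun τ hτ =>
    (hK.mono fun x hx => lt_of_lt_of_le (lt_min ht hτ) hx.1).intervalIntegrable
  have key : ∀ τ, 0 < τ → X τ = X t + ∫ x in t..τ, K x := by
    intro τ hτ
    rw [← sub_eq_iff_eq_add']
    apply L2.dist_injective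
    ext ψ
    obtain ⟨Λ, hl⟩ := L2.exists_dist_apply_eq ψ
    simp only [hl] at h ⊢
    rw [map_sub, ← ContinuousLinearMap.intervalIntegral_comp_comm _ (hint τ hτ)]
    have hsub : ∀ x ∈ Set.uIcc t τ, 0 < x := fun x hx => lt_of_lt_of_le (lt_min ht hτ) hx.1
    symm
    refine intervalIntegral.integral_eq_sub_of_hasDerivAt
      (f := fun τ => Λ (X τ))
      (fun x hx => ?_) ?_
    · have := h ψ x (hsub x hx)
      simpa only [hl] using this
    · refine ContinuousOn.intervalIntegrable ?_
      exact Λ.continuous.comp_continuousOn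
        (hK.mono fun x hx => hsub x hx)
  have hd : HasDerivAt (fun τ => X t + ∫ x in t..τ, K x) (K t) t :=
    (intervalIntegral.integral_hasDerivAt_right (hint t ht)
      (hK.stronglyMeasurableAtFilter isOpen_Ioi t ht)
      (hK.continuousAt (Ioi_mem_nhds ht))).const_add _
  refine hd.congr_of_eventuallyEq ?_
  filter_upwards [lt_mem_nhds ht] with τ hτ
  exact key τ hτ

theorem memLp_top_indicator_of_continuous {E : Set (EuclideanSpace ℝ (Fin n))}
    (hE : MeasurableSet E) (hb : Bornology.IsBounded E) {m : EuclideanSpace ℝ (Fin n) → ℝ}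
    (hm : Continuous m) : MemLp (E.indicator m) ∞ volume := by
  obtain ⟨C, hC⟩ := (hb.isCompact_closure.exists_bound_of_continuousOn hm.continuousOn)
  refine memLp_top_of_bound (hm.measurable.indicator hE).aestronglyMeasurable (max C 0)
    (.of_forall fun x => ?_)
  by_cases hx : x ∈ E
  · simpa [hx] using Or.inl (hC x (subset_closure hx))
  · simp [hx]

theorem dist_mulCLM {χ m : EuclideanSpace ℝ (Fin n) → ℝ} (hχ : HasCompactSupport χ)
    (hχ' : ContDiff ℝ (⊤ : ℕ∞) χ) (hm : Continuous m) (f : L2 n)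
    (ψ : 𝓢(EuclideanSpace ℝ (Fin n), ℂ)) :
    L2.dist (mulCLM volume (fun ξ => χ ξ * m ξ) f) ψ =
      ∫ ξ, SchwartzMap.smulLeftCLM ℂ χ ψ ξ * (m ξ : ℂ) * f ξ := by
  have hg : χ.HasTemperateGrowth := (hχ.toSchwartzMap hχ').hasTemperateGrowth
  have hM : MemLp (fun ξ => χ ξ * m ξ) ∞ volume :=
    (hχ'.continuous.mul hm).memLp_top_of_hasCompactSupport hχ.mul_right _
  rw [L2.dist_apply]
  refine integral_congr_ae ?_
  filter_upwards [coeFn_mulCLM hM f] with x hx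
  rw [hx, SchwartzMap.smulLeftCLM_apply_apply hg, Complex.real_smul]
  push_cast
  ring

end WeakDerivative

section Localization

variable {n : ℕ} {ι : Type*} [Fintype ι]

/-- The multipliers are unbounded and an indicator is not an admissible factor of a test function. A
smooth bump equal to 1 on E is: it moves onto ψ, makes the multipliers bounded, and gives a strong
derivative, which is then multiplied by the indicator. -/
theorem hasDerivAt_mulCLM_indicator {X : ℝ → L2 n} {Y : ι → ℝ → L2 n}
    {m : ι → EuclideanSpace ℝ (Fin n) → ℝ} (hm : ∀ i, Continuous (m i))
    (hY : ∀ i, ContinuousOn (Y i) (Set.Ioi 0))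
    (h : ∀ ψ : 𝓢(EuclideanSpace ℝ (Fin n), ℂ), ∀ t, 0 < t →
      HasDerivAt (fun τ => ∫ ξ, ψ ξ * X τ ξ) (∑ i, ∫ ξ, ψ ξ * (m i ξ : ℂ) * Y i t ξ) t)
    {E : Set (EuclideanSpace ℝ (Fin n))} (hE : MeasurableSet E) (hb : Bornology.IsBounded E)
    {t : ℝ} (ht : 0 < t) :
    HasDerivAt (fun τ => mulCLM volume (E.indicator 1) (X τ))
      (∑ i, mulCLM volume (E.indicator (m i)) (mulCLM volume (E.indicator 1) (Y i t))) t := by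
  obtain ⟨r, hr⟩ := hb.subset_closedBall 0
  let χ : ContDiffBump (0 : EuclideanSpace ℝ (Fin n)) :=
    ⟨max r 1, max r 1 + 1, by positivity, by linarith⟩
  have hχE : ∀ ξ ∈ E, χ ξ = 1 := fun ξ hξ =>
    χ.one_of_mem_closedBall (Metric.closedBall_subset_closedBall (le_max_left _ _) (hr hξ))
  have hχ : HasCompactSupport χ := χ.hasCompactSupport
  have hχ' : ContDiff ℝ (⊤ : ℕ∞) χ := χ.contDiff
  have hd := hasDerivAt_of_forall_dist (X := fun τ => mulCLM volume (fun ξ => χ ξ * 1) (X τ))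
    (K := fun τ => ∑ i, mulCLM volume (fun ξ => χ ξ * m i ξ) (Y i τ))
    (continuousOn_finsetSum _ fun i _ =>
      (ContinuousLinearMap.continuous _).comp_continuousOn (hY i)) (fun ψ s hs => by
        obtain ⟨Λ, hΛ⟩ := L2.exists_dist_apply_eq ψ
        have e1 : ∀ τ, L2.dist (mulCLM volume (fun ξ => χ ξ * 1) (X τ)) ψ =
            ∫ ξ, SchwartzMap.smulLeftCLM ℂ χ ψ ξ * X τ ξ := by
          intro τ
          simpa using dist_mulCLM hχ hχ' (m := fun _ => 1) continuous_const (X τ) ψ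
        simp only [e1]
        convert! h (SchwartzMap.smulLeftCLM ℂ χ ψ) s hs using 1
        rw [hΛ, map_sum]
        refine Finset.sum_congr rfl fun i _ => ?_
        rw [← hΛ, dist_mulCLM hχ hχ' (hm i)]) ht
  have h1E : MemLp (E.indicator (1 : EuclideanSpace ℝ (Fin n) → ℝ)) ∞ volume :=
    memLp_top_indicator_of_continuous hE hb continuous_const
  have hχm : ∀ {f : EuclideanSpace ℝ (Fin n) → ℝ}, Continuous f →
      MemLp (fun ξ => χ ξ * f ξ) ∞ volume := fun {f} hf =>
    (hχ'.continuous.mul hf).memLp_top_of_hasCompactSupport hχ.mul_right _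
  have := (mulCLM volume (E.indicator 1)).hasFDerivAt.comp_hasDerivAt t hd
  convert! this using 1
  · ext1 τ
    refine (mulCLM_mulCLM h1E (hχm continuous_const) h1E (fun ξ => ?_) (X τ)).symm
    by_cases hξ : ξ ∈ E
    · simp [hξ, hχE ξ hξ]
    · simp [hξ]
  · rw [map_sum]
    refine Finset.sum_congr rfl fun i _ => ?_
    have hmE := memLp_top_indicator_of_continuous hE hb (hm i)
    rw [mulCLM_mulCLM hmE h1E hmE, mulCLM_mulCLM h1E (hχm (hm i)) hmE]
    · intro ξ
      by_cases hξ : ξ ∈ E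
      · simp [hξ, hχE ξ hξ]
      · simp [hξ]
    · intro ξ
      by_cases hξ : ξ ∈ E <;> simp [hξ]

end Localization

/-! ### Integrated quadratic forms and Grönwall's inequality. -/

section Lyapunov

variable {α : Type*} [MeasurableSpace α] {μ : Measure α} {ι : Type*} [Fintype ι]

/-- The quadratic form with coefficients `S i j`. -/
def quadForm (S : ι → ι → ℝ) (v : ι → ℝ) : ℝ := ∑ i, ∑ j, S i j * (v i * v j)

/-- The derivative of `quadForm S` along the linear system `v' = m v`. -/
def quadFormDeriv (S m : ι → ι → ℝ) (v : ι → ℝ) : ℝ :=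
  ∑ i, ∑ j, S i j * ((∑ k, m i k * v k) * v j + v i * ∑ k, m j k * v k)

/-- The quadratic form with coefficients `S i j` applied to the real and the imaginary parts. -/
def hermForm (S : ι → ι → ℝ) (z : ι → ℂ) : ℝ :=
  quadForm S (fun i => (z i).re) + quadForm S (fun i => (z i).im)

theorem hermForm_eq (S : ι → ι → ℝ) (z : ι → ℂ) :
    hermForm S z = ∑ i, ∑ j, inner ℝ (z j) ((S i j : ℂ) * z i) := by
  simp only [hermForm, quadForm, ← Finset.sum_add_distrib, Complex.inner]
  refine Finset.sum_congr rfl fun i _ => Finset.sum_congr rfl fun j _ => ?_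
  simp
  ring

variable {S : ι → ι → α → ℝ}

theorem integrable_inner_mulCLM {m : α → ℝ} (hm : MemLp m ∞ μ) (f g : Lp ℂ 2 μ) :
    Integrable (fun x => inner ℝ (f x) ((m x : ℂ) * g x)) μ := by
  refine (L2.integrable_inner f (mulCLM μ m g)).congr ?_
  filter_upwards [coeFn_mulCLM hm g] with x hx
  rw [hx]

theorem inner_mulCLM_eq_integral {m : α → ℝ} (hm : MemLp m ∞ μ) (f g : Lp ℂ 2 μ) :
    inner ℝ f (mulCLM μ m g) = ∫ x, inner ℝ (f x) ((m x : ℂ) * g x) ∂μ := by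
  rw [L2.inner_def]
  refine integral_congr_ae ?_
  filter_upwards [coeFn_mulCLM hm g] with x hx
  rw [hx]

theorem integrable_hermForm (hS : ∀ i j, MemLp (S i j) ∞ μ) (z : ι → Lp ℂ 2 μ) :
    Integrable (fun x => hermForm (fun i j => S i j x) (fun i => z i x)) μ := by
  simp only [hermForm_eq]
  exact integrable_finsetSum _ fun i _ => integrable_finsetSum _ fun j _ =>
    integrable_inner_mulCLM (hS i j) _ _

theorem integral_hermForm (hS : ∀ i j, MemLp (S i j) ∞ μ) (z : ι → Lp ℂ 2 μ) :
    ∫ x, hermForm (fun i j => S i j x) (fun i => z i x) ∂μ =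
      ∑ i, ∑ j, inner ℝ (z j) (mulCLM μ (S i j) (z i)) := by
  simp only [hermForm_eq]
  rw [integral_finsetSum _ fun i _ => integrable_finsetSum _ fun j _ =>
    integrable_inner_mulCLM (hS i j) _ _]
  refine Finset.sum_congr rfl fun i _ => ?_
  rw [integral_finsetSum _ fun j _ => integrable_inner_mulCLM (hS i j) _ _]
  exact Finset.sum_congr rfl fun j _ => (inner_mulCLM_eq_integral (hS i j) _ _).symm

theorem integral_hermForm_le_exp_mul {m : ι → ι → α → ℝ} (hm : ∀ i j, MemLp (m i j) ∞ μ)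
    (hS : ∀ i j, MemLp (S i j) ∞ μ) {z : ι → ℝ → Lp ℂ 2 μ}
    (hz : ∀ i, ContinuousOn (z i) (Set.Ici 0))
    (hd : ∀ i t, 0 < t → HasDerivAt (z i) (∑ k, mulCLM μ (m i k) (z k t)) t) {l : ℝ}
    (hle : ∀ x v, quadFormDeriv (fun i j => S i j x) (fun i j => m i j x) v ≤
      -l * quadForm (fun i j => S i j x) v) {t : ℝ} (ht : 0 ≤ t) :
    ∫ x, hermForm (fun i j => S i j x) (fun i => z i t x) ∂μ ≤
      Real.exp (-l * t) * ∫ x, hermForm (fun i j => S i j x) (fun i => z i 0 x) ∂μ := by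
  set F : ℝ → ℝ := fun t => ∫ x, hermForm (fun i j => S i j x) (fun i => z i t x) ∂μ with hF
  have hF' : F = fun t => ∑ i, ∑ j, inner ℝ (z j t) (mulCLM μ (S i j) (z i t)) :=
    funext fun t => integral_hermForm hS _
  have hcont : ContinuousOn F (Set.Ici 0) := by
    rw [hF']
    exact continuousOn_finsetSum _ fun i _ => continuousOn_finsetSum _ fun j _ =>
      (hz j).inner ((mulCLM μ (S i j)).continuous.comp_continuousOn (hz i))
  have hder : ∀ t, 0 < t → ∃ d, HasDerivAt F d t ∧ d ≤ -l * F t := by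
    intro t ht
    refine ⟨∑ i, ∑ j, (inner ℝ (z j t) (mulCLM μ (S i j) (∑ k, mulCLM μ (m i k) (z k t)))
      + inner ℝ (∑ k, mulCLM μ (m j k) (z k t)) (mulCLM μ (S i j) (z i t))), ?_, ?_⟩
    · rw [hF']
      refine HasDerivAt.fun_sum fun i _ => HasDerivAt.fun_sum fun j _ => ?_
      exact (hd j t ht).inner ℝ ((mulCLM μ (S i j)).hasFDerivAt.comp_hasDerivAt t (hd i t ht))
    · set z' : ι → Lp ℂ 2 μ := fun i => ∑ k, mulCLM μ (m i k) (z k t) with hz'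
      have hae : ∀ᵐ x ∂μ, ∀ i, z' i x = ∑ k, (m i k x : ℂ) * z k t x := by
        refine ae_all_iff.2 fun i => ?_
        have h1 : ∀ᵐ x ∂μ, ∀ k, mulCLM μ (m i k) (z k t) x = (m i k x : ℂ) * z k t x :=
          ae_all_iff.2 fun k => coeFn_mulCLM (hm i k) _
        filter_upwards [h1, Lp.coeFn_finsetSum Finset.univ fun k => mulCLM μ (m i k) (z k t)]
          with x h1 h2
        rw [hz', h2, Finset.sum_apply]
        exact Finset.sum_congr rfl fun k _ => h1 k
      have hI : ∀ i j, Integrable (fun x => inner ℝ (z j t x) ((S i j x : ℂ) * z' i x)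
          + inner ℝ (z' j x) ((S i j x : ℂ) * z i t x)) μ := fun i j =>
        (integrable_inner_mulCLM (hS i j) _ _).add (integrable_inner_mulCLM (hS i j) _ _)
      have hsum : ∑ i, ∑ j, (inner ℝ (z j t) (mulCLM μ (S i j) (z' i))
          + inner ℝ (z' j) (mulCLM μ (S i j) (z i t))) =
          ∫ x, ∑ i, ∑ j, (inner ℝ (z j t x) ((S i j x : ℂ) * z' i x)
          + inner ℝ (z' j x) ((S i j x : ℂ) * z i t x)) ∂μ := by
        rw [integral_finsetSum _ fun i _ => integrable_finsetSum _ fun j _ => hI i j]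
        refine Finset.sum_congr rfl fun i _ => ?_
        rw [integral_finsetSum _ fun j _ => hI i j]
        refine Finset.sum_congr rfl fun j _ => ?_
        rw [integral_add (integrable_inner_mulCLM (hS i j) _ _)
          (integrable_inner_mulCLM (hS i j) _ _), inner_mulCLM_eq_integral (hS i j),
          inner_mulCLM_eq_integral (hS i j)]
      rw [hsum, hF, ← integral_const_mul]
      refine integral_mono_ae
        (integrable_finsetSum _ fun i _ => integrable_finsetSum _ fun j _ => hI i j)
        ((integrable_hermForm hS _).const_mul _) ?_
      filter_upwards [hae] with x hx
      -- The coefficients are real, so real and imaginary parts evolve separately under the same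
      -- system.
      have h1 := hle x fun i => (z i t x).re
      have h2 := hle x fun i => (z i t x).im
      simp only [hermForm, mul_add]
      refine le_trans (le_of_eq ?_) (add_le_add h1 h2)
      simp only [quadFormDeriv, ← Finset.sum_add_distrib]
      refine Finset.sum_congr rfl fun i _ => Finset.sum_congr rfl fun j _ => ?_
      have hre : ∀ i, (z' i x).re = ∑ k, m i k x * (z k t x).re := by
        intro i; simp [hx]
      have him : ∀ i, (z' i x).im = ∑ k, m i k x * (z k t x).im := by
        intro i; simp [hx]
      simp only [← hre, ← him, Complex.inner]
      simp
      ring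
  have hanti : AntitoneOn (fun t => Real.exp (l * t) * F t) (Set.Ici 0) := by
    have hexp : ∀ t, HasDerivAt (fun t => Real.exp (l * t)) (Real.exp (l * t) * l) t :=
      fun t => ((hasDerivAt_id t).const_mul l).exp.congr_deriv (by simp)
    refine antitoneOn_of_deriv_nonpos (convex_Ici 0)
      ((Real.continuous_exp.comp (continuous_const.mul continuous_id)).continuousOn.mul hcont)
      (fun t ht => ?_) (fun t ht => ?_)
    · rw [interior_Ici] at ht
      obtain ⟨d, hd, -⟩ := hder t ht
      exact ((hexp t).fun_mul hd).differentiableAt.differentiableWithinAt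
    · rw [interior_Ici] at ht
      obtain ⟨d, hd, hd'⟩ := hder t ht
      rw [((hexp t).fun_mul hd).deriv]
      have := Real.exp_pos (l * t)
      nlinarith
  have h0 := hanti (Set.mem_Ici.2 le_rfl) (Set.mem_Ici.2 ht) ht
  simp only [mul_zero, Real.exp_zero, one_mul] at h0
  have he : Real.exp (-l * t) * Real.exp (l * t) = 1 := by rw [← Real.exp_add]; simp
  calc F t = Real.exp (-l * t) * (Real.exp (l * t) * F t) := by rw [← mul_assoc, he, one_mul]
    _ ≤ _ := mul_le_mul_of_nonneg_left h0 (Real.exp_pos _).le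

end Lyapunov

/-! ### The plate system localized in frequency. -/

/-- The coefficient matrix of the system satisfied by the Fourier transforms of
`(|D|²u, u_t, θ)`, where `p` and `q` are the symbols of `-Δ` and `(-Δ)^σ`. -/
def plateMatrix (p q : ℝ) : Fin 3 → Fin 3 → ℝ :=
  ![![0, p, 0], ![-p, -q, p], ![0, -p, -p]]

/-- The Fourier transforms of `(w, v, θ)` at the frequency `ξ`. -/
noncomputable def fourierState {n : ℕ} (w v θ : L2 n) : Fin 3 → L2 n := ![𝓕 w, 𝓕 v, 𝓕 θ]

namespace IsThermoPlateSolution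

variable {n : ℕ} {σ : ℝ} {u₀ : 𝓢'(EuclideanSpace ℝ (Fin n), ℂ)} {u₁ θ₀ : L2 n}
  {u : ℝ → 𝓢'(EuclideanSpace ℝ (Fin n), ℂ)} {w ut θ : ℝ → L2 n}

theorem continuousOn_fourierState (h : IsThermoPlateSolution σ u₀ u₁ θ₀ u w ut θ) (i : Fin 3) :
    ContinuousOn (fun t => fourierState (w t) (ut t) (θ t) i) (Set.Ici 0) := by
  have hF : Continuous (fun f : L2 n => (𝓕 f : L2 n)) :=
    (Lp.fourierTransformₗᵢ (EuclideanSpace ℝ (Fin n)) ℂ).continuous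
  fin_cases i
  · exact hF.comp_continuousOn h.w_cont
  · exact hF.comp_continuousOn h.ut_cont
  · exact hF.comp_continuousOn h.θ_cont

theorem hasDerivAt_fourierState (hσ : 0 ≤ σ) (h : IsThermoPlateSolution σ u₀ u₁ θ₀ u w ut θ)
    {E : Set (EuclideanSpace ℝ (Fin n))} (hE : MeasurableSet E) (hb : Bornology.IsBounded E)
    (i : Fin 3) {t : ℝ} (ht : 0 < t) :
    HasDerivAt (fun τ => mulCLM volume (E.indicator 1) (fourierState (w τ) (ut τ) (θ τ) i))
      (∑ k, mulCLM volume
        (E.indicator fun ξ => plateMatrix ((2 * π * ‖ξ‖) ^ 2) ((2 * π * ‖ξ‖) ^ (2 * σ)) i k)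
        (mulCLM volume (E.indicator 1) (fourierState (w t) (ut t) (θ t) k))) t := by
  have hq : Continuous fun ξ : EuclideanSpace ℝ (Fin n) => (2 * π * ‖ξ‖) ^ (2 * σ) :=
    (by fun_prop : Continuous fun ξ : EuclideanSpace ℝ (Fin n) => 2 * π * ‖ξ‖).rpow_const
      fun _ => Or.inr (by linarith)
  refine hasDerivAt_mulCLM_indicator (X := fun τ => fourierState (w τ) (ut τ) (θ τ) i)
    (Y := fun k τ => fourierState (w τ) (ut τ) (θ τ) k) (fun k => ?_)
    (fun k => (h.continuousOn_fourierState k).mono Set.Ioi_subset_Ici_self)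
    (fun ψ t ht => ?_) hE hb ht
  · fin_cases i <;> fin_cases k <;> simp [plateMatrix] <;> fun_prop
  · fin_cases i
    · simpa [Fin.sum_univ_three, plateMatrix, fourierState] using h.hasDerivAt_fourier_w ψ ht
    · have := h.hasDerivAt_fourier_ut ψ ht
      simp [Fin.sum_univ_three, plateMatrix, fourierState, integral_neg] at this ⊢
      convert! this using 1
      ring
    · have := h.hasDerivAt_fourier_θ ψ ht
      simp [Fin.sum_univ_three, plateMatrix, fourierState, integral_neg] at this ⊢
      convert! this using 1
      ring

/-- The integrated inequality holds on every measurable subset of E, hence the integrands are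
ordered almost everywhere. The rate l has to be constant on E. -/
theorem hermForm_le_exp_mul (hσ : 0 ≤ σ) (h : IsThermoPlateSolution σ u₀ u₁ θ₀ u w ut θ)
    {E : Set (EuclideanSpace ℝ (Fin n))} (hE : MeasurableSet E) (hb : Bornology.IsBounded E)
    {S : Fin 3 → Fin 3 → EuclideanSpace ℝ (Fin n) → ℝ} (hS : ∀ i j, Continuous (S i j)) {l : ℝ}
    (hle : ∀ ξ ∈ E, ∀ v, quadFormDeriv (fun i j => S i j ξ)
      (plateMatrix ((2 * π * ‖ξ‖) ^ 2) ((2 * π * ‖ξ‖) ^ (2 * σ))) v ≤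
      -l * quadForm (fun i j => S i j ξ) v) {t : ℝ} (ht : 0 ≤ t) :
    ∀ᵐ ξ, ξ ∈ E →
      hermForm (fun i j => S i j ξ) (fun i => fourierState (w t) (ut t) (θ t) i ξ) ≤
        Real.exp (-l * t) *
          hermForm (fun i j => S i j ξ) (fun i => fourierState (w 0) (ut 0) (θ 0) i ξ) := by
  set z : Fin 3 → ℝ → L2 n := fun i t => fourierState (w t) (ut t) (θ t) i with hz
  have hq : Continuous fun ξ : EuclideanSpace ℝ (Fin n) => (2 * π * ‖ξ‖) ^ (2 * σ) :=
    (by fun_prop : Continuous fun ξ : EuclideanSpace ℝ (Fin n) => 2 * π * ‖ξ‖).rpow_const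
      fun _ => Or.inr (by linarith)
  have hloc : ∀ A : Set (EuclideanSpace ℝ (Fin n)), MeasurableSet A → A ⊆ E → ∀ τ,
      (fun ξ => hermForm (fun i j => A.indicator (S i j) ξ)
        (fun i => mulCLM volume (A.indicator 1) (z i τ) ξ)) =ᵐ[volume]
      A.indicator fun ξ => hermForm (fun i j => S i j ξ) (fun i => z i τ ξ) := by
    intro A hA hAE τ
    have h1A : MemLp (A.indicator (1 : EuclideanSpace ℝ (Fin n) → ℝ)) ∞ volume :=
      memLp_top_indicator_of_continuous hA (hb.subset hAE) continuous_const
    have hae : ∀ᵐ ξ, ∀ i, mulCLM volume (A.indicator 1) (z i τ) ξ =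
        ((A.indicator 1 ξ : ℝ) : ℂ) * z i τ ξ :=
      ae_all_iff.2 fun i => coeFn_mulCLM h1A _
    filter_upwards [hae] with ξ hξ
    by_cases hmem : ξ ∈ A
    · simp [hξ, hmem]
    · simp [hmem, hermForm, quadForm]
  have hint : ∀ A : Set (EuclideanSpace ℝ (Fin n)), MeasurableSet A → A ⊆ E → ∀ τ,
      Integrable (A.indicator fun ξ => hermForm (fun i j => S i j ξ) (fun i => z i τ ξ)) :=
    fun A hA hAE τ => (integrable_hermForm (S := fun i j => A.indicator (S i j))
      (fun i j => memLp_top_indicator_of_continuous hA (hb.subset hAE) (hS i j))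
      (fun i => mulCLM volume (A.indicator 1) (z i τ))).congr (hloc A hA hAE τ)
  have hmain : ∀ A : Set (EuclideanSpace ℝ (Fin n)), MeasurableSet A → A ⊆ E →
      ∫ ξ, A.indicator (fun ξ => hermForm (fun i j => S i j ξ) (fun i => z i t ξ)) ξ ≤
        Real.exp (-l * t) *
          ∫ ξ, A.indicator (fun ξ => hermForm (fun i j => S i j ξ) (fun i => z i 0 ξ)) ξ := by
    intro A hA hAE
    have hbA := hb.subset hAE
    rw [← integral_congr_ae (hloc A hA hAE t), ← integral_congr_ae (hloc A hA hAE 0)]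
    refine integral_hermForm_le_exp_mul (S := fun i j => A.indicator (S i j))
      (m := fun i k => A.indicator fun ξ =>
        plateMatrix ((2 * π * ‖ξ‖) ^ 2) ((2 * π * ‖ξ‖) ^ (2 * σ)) i k)
      (z := fun i τ => mulCLM volume (A.indicator 1) (z i τ))
      (fun i k => memLp_top_indicator_of_continuous hA hbA ?_)
      (fun i j => memLp_top_indicator_of_continuous hA hbA (hS i j))
      (fun i => (ContinuousLinearMap.continuous _).comp_continuousOn
        (h.continuousOn_fourierState i))
      (fun i t ht => h.hasDerivAt_fourierState hσ hA hbA i ht) (fun ξ v => ?_) ht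
    · fin_cases i <;> fin_cases k <;> simp [plateMatrix] <;> fun_prop
    · by_cases hξ : ξ ∈ A
      · simpa [hξ] using hle ξ (hAE hξ) v
      · simp [hξ, quadFormDeriv, quadForm]
  have := ae_le_of_forall_setIntegral_le (hint E hE subset_rfl t)
    ((hint E hE subset_rfl 0).const_mul (Real.exp (-l * t))) (fun s hs _ => by
      have := hmain (s ∩ E) (hs.inter hE) Set.inter_subset_right
      rw [integral_const_mul, ← integral_indicator hs, ← integral_indicator hs]
      simpa only [Set.indicator_indicator] using this)
  filter_upwards [this] with ξ hξ hmem
  simpa [hmem] using hξ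

end IsThermoPlateSolution

/-! ### Algebra of the Lyapunov forms. -/

/-- The coefficients of the quadratic form `g |v|² + 2 a v₁ v₂ + 2 b v₀ v₁`. -/
def lyapunovMatrix (g a b : ℝ) : Fin 3 → Fin 3 → ℝ := ![![g, b, 0], ![b, g, a], ![0, a, g]]

theorem quadForm_lyapunovMatrix (g a b : ℝ) (v : Fin 3 → ℝ) :
    quadForm (lyapunovMatrix g a b) v =
      g * (v 0 ^ 2 + v 1 ^ 2 + v 2 ^ 2) + 2 * a * (v 1 * v 2) + 2 * b * (v 0 * v 1) := by
  simp [quadForm, lyapunovMatrix, Fin.sum_univ_three]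
  ring

theorem quadFormDeriv_lyapunovMatrix (g a b p q : ℝ) (v : Fin 3 → ℝ) :
    quadFormDeriv (lyapunovMatrix g a b) (plateMatrix p q) v =
      2 * (-g * (p * v 2 ^ 2 + q * v 1 ^ 2)
        + a * (p * v 2 ^ 2 - p * v 1 ^ 2 - p * (v 0 * v 2) - (p + q) * (v 1 * v 2))
        + b * (p * v 1 ^ 2 - p * v 0 ^ 2 + p * (v 0 * v 2) - q * (v 0 * v 1))) := by
  simp [quadFormDeriv, lyapunovMatrix, plateMatrix, Fin.sum_univ_three]
  ring

/-- Here q may be much smaller than p, so damping of v₁ comes from the term in v₁v₂, which produces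
-p v₁² but also +p v₂², absorbed by the heat dissipation. The term in v₀v₁ produces -p v₀² at the
price of +p v₁²; its weight 1/40 is therefore below 1/10. -/
theorem quadFormDeriv_le_of_low_frequency {p q r : ℝ} (hq : 0 ≤ q) (hqp : q ≤ p) (hr : r ≤ p)
    (v : Fin 3 → ℝ) :
    quadFormDeriv (lyapunovMatrix 1 (1 / 10) (1 / 40)) (plateMatrix p q) v ≤
      -(r / 200) * quadForm (lyapunovMatrix 1 (1 / 10) (1 / 40)) v := by
  rw [quadFormDeriv_lyapunovMatrix, quadForm_lyapunovMatrix]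
  generalize v 0 = x
  generalize v 1 = y
  generalize v 2 = z
  set N := x ^ 2 + y ^ 2 + z ^ 2 with hN
  have hQ0 : 0 ≤ 1 * N + 2 * (1 / 10) * (y * z) + 2 * (1 / 40) * (x * y) := by
    nlinarith [sq_nonneg (y + z), sq_nonneg (x + y), sq_nonneg x, sq_nonneg y, sq_nonneg z]
  have hQ1 : 1 * N + 2 * (1 / 10) * (y * z) + 2 * (1 / 40) * (x * y) ≤ 6 / 5 * N := by
    nlinarith [sq_nonneg (y - z), sq_nonneg (x - y), sq_nonneg x, sq_nonneg y, sq_nonneg z]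
  have hp : 0 ≤ p := hq.trans hqp
  have hD : 2 * (-1 * (p * z ^ 2 + q * y ^ 2)
      + 1 / 10 * (p * z ^ 2 - p * y ^ 2 - p * (x * z) - (p + q) * (y * z))
      + 1 / 40 * (p * y ^ 2 - p * x ^ 2 + p * (x * z) - q * (x * y))) ≤ -(p / 100) * N := by
    -- The terms carrying p leave a negative reserve. Since q ≤ p, a share q of it absorbs the
    -- indefinite terms carrying q, and the rest is dropped.
    have h1 : -(9 / 10) * z ^ 2 - (1 / 10 - 1 / 40) * y ^ 2 - 1 / 40 * x ^ 2
        - (1 / 10 - 1 / 40) * (x * z) - 1 / 10 * (y * z) + 1 / 200 * N ≤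
        -(1 / 5) * z ^ 2 - 1 / 40 * y ^ 2 - 1 / 200 * x ^ 2 := by
      nlinarith [sq_nonneg (x + 5 * z), sq_nonneg (y + 2 * z), sq_nonneg x, sq_nonneg y,
        sq_nonneg z]
    have h2 : -(1 / 5) * z ^ 2 - 1 / 40 * y ^ 2 - 1 / 200 * x ^ 2 ≤ 0 := by nlinarith
    have h3 : -(1 / 5) * z ^ 2 - 1 / 40 * y ^ 2 - 1 / 200 * x ^ 2 - y ^ 2 - 1 / 10 * (y * z)
        - 1 / 40 * (x * y) ≤ 0 := by
      nlinarith [sq_nonneg (y + 2 * z), sq_nonneg (x + 3 * y), sq_nonneg x, sq_nonneg y,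
        sq_nonneg z]
    nlinarith [mul_le_mul_of_nonneg_left h1 hp, mul_le_mul_of_nonneg_left h3 hq,
      mul_le_mul_of_nonneg_left h2 (sub_nonneg.2 hqp)]
  nlinarith [mul_le_mul_of_nonneg_right hr hQ0, mul_le_mul_of_nonneg_left hQ1 hp,
    (by positivity : 0 ≤ p * N)]

/-- Meant for a = ρ^(2-σ) and b = ρ^σ, so that ab = p and b² = q; a ≥ 1 encodes σ ≤ 2. Since q can
dominate p, a constant weight on v₀v₁ would make q v₀v₁ uncontrollable. The weight a/(4b) turns it
into (a v₀)(b v₁)/4 and still yields the dissipation (a v₀)²/4, so everything is a quadratic form in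
a v₀, b v₁, a v₂. -/
theorem quadFormDeriv_le_of_high_frequency {a b : ℝ} (ha : 1 ≤ a) (hab : a ≤ b)
    (v : Fin 3 → ℝ) :
    quadFormDeriv (lyapunovMatrix 1 0 (a / b / 4)) (plateMatrix (a * b) (b ^ 2)) v ≤
      -(1 / 5) * quadForm (lyapunovMatrix 1 0 (a / b / 4)) v := by
  rw [quadFormDeriv_lyapunovMatrix, quadForm_lyapunovMatrix]
  generalize v 0 = x
  generalize v 1 = y
  generalize v 2 = z
  have hb : 0 < b := by linarith
  obtain ⟨d, hd⟩ : ∃ d, d = a / b := ⟨_, rfl⟩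
  have hdb : d * b = a := by rw [hd]; field_simp
  have hd0 : 0 ≤ d := by rw [hd]; positivity
  have hd1 : d ≤ 1 := by rw [hd, div_le_one hb]; exact hab
  rw [← hd]
  have e : 2 * (-1 * (a * b * z ^ 2 + b ^ 2 * y ^ 2)
      + 0 * (a * b * z ^ 2 - a * b * y ^ 2 - a * b * (x * z) - (a * b + b ^ 2) * (y * z))
      + d / 4 * (a * b * y ^ 2 - a * b * x ^ 2 + a * b * (x * z) - b ^ 2 * (x * y))) =
      -2 * (a * b * z ^ 2) - 2 * (b * y) ^ 2 + 1 / 2 * (a * y) ^ 2 - 1 / 2 * (a * x) ^ 2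
        + 1 / 2 * ((a * x) * (a * z)) - 1 / 2 * ((a * x) * (b * y)) := by
    rw [← hdb]; ring
  rw [e]
  have h1 : (a * z) ^ 2 ≤ a * b * z ^ 2 := by
    have := mul_le_mul_of_nonneg_right hab (by positivity : 0 ≤ a * z ^ 2)
    nlinarith
  have h2 : (a * y) ^ 2 ≤ (b * y) ^ 2 := by
    rw [mul_pow, mul_pow]
    exact mul_le_mul_of_nonneg_right (pow_le_pow_left₀ (by linarith) hab 2) (sq_nonneg y)
  have h3 : ∀ w : ℝ, w ^ 2 ≤ (a * w) ^ 2 := fun w => by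
    rw [mul_pow]
    exact le_mul_of_one_le_left (sq_nonneg w) (one_le_pow₀ ha)
  have h4 : d * (x * y) ≤ (x ^ 2 + y ^ 2) / 2 := by
    nlinarith [mul_nonneg hd0 (sq_nonneg (x - y)),
      mul_nonneg (sub_nonneg.2 hd1) (add_nonneg (sq_nonneg x) (sq_nonneg y))]
  nlinarith [h3 x, h3 y, h3 z, sq_nonneg (a * x - 2 * (a * z)), sq_nonneg (a * x + 2 * (b * y)),
    sq_nonneg (a * x), sq_nonneg (b * y), sq_nonneg (a * z)]

/-- The sign -1 turns an upper estimate of the form into a lower bound for the energy. -/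
theorem quadFormDeriv_neg_le {p q r : ℝ} (hq : 0 ≤ q) (hqp : q ≤ p) (hr : p ≤ r)
    (v : Fin 3 → ℝ) :
    quadFormDeriv (lyapunovMatrix (-1) 0 0) (plateMatrix p q) v ≤
      -(2 * r) * quadForm (lyapunovMatrix (-1) 0 0) v := by
  rw [quadFormDeriv_lyapunovMatrix, quadForm_lyapunovMatrix]
  nlinarith [mul_le_mul_of_nonneg_right hr (sq_nonneg (v 2)), mul_le_mul_of_nonneg_right
    (hqp.trans hr) (sq_nonneg (v 1)), mul_nonneg (hq.trans (hqp.trans hr)) (sq_nonneg (v 0))]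

theorem hermForm_lyapunovMatrix (g : ℝ) (z : Fin 3 → ℂ) :
    hermForm (lyapunovMatrix g 0 0) z = g * ∑ i, ‖z i‖ ^ 2 := by
  simp only [hermForm, quadForm_lyapunovMatrix, Fin.sum_univ_three, Complex.sq_norm,
    Complex.normSq_apply]
  ring

theorem hermForm_lyapunovMatrix_bounds {a b : ℝ} (ha : 0 ≤ a) (hb : 0 ≤ b)
    (hab : a + b ≤ 1 / 4) (z : Fin 3 → ℂ) :
    1 / 2 * ∑ i, ‖z i‖ ^ 2 ≤ hermForm (lyapunovMatrix 1 a b) z ∧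
      hermForm (lyapunovMatrix 1 a b) z ≤ 2 * ∑ i, ‖z i‖ ^ 2 := by
  have key : ∀ v : Fin 3 → ℝ, 1 / 2 * (v 0 ^ 2 + v 1 ^ 2 + v 2 ^ 2) ≤
      quadForm (lyapunovMatrix 1 a b) v ∧
      quadForm (lyapunovMatrix 1 a b) v ≤ 2 * (v 0 ^ 2 + v 1 ^ 2 + v 2 ^ 2) := by
    intro v
    rw [quadForm_lyapunovMatrix]
    constructor <;>
    nlinarith [mul_nonneg ha (sq_nonneg (v 1 + v 2)), mul_nonneg hb (sq_nonneg (v 0 + v 1)),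
      mul_nonneg ha (sq_nonneg (v 1 - v 2)), mul_nonneg hb (sq_nonneg (v 0 - v 1)),
      mul_nonneg ha (sq_nonneg (v 0)), mul_nonneg hb (sq_nonneg (v 2)),
      mul_nonneg (sub_nonneg.2 hab) (by positivity : 0 ≤ v 0 ^ 2 + v 1 ^ 2 + v 2 ^ 2)]
  obtain ⟨h1, h2⟩ := key fun i => (z i).re
  obtain ⟨h3, h4⟩ := key fun i => (z i).im
  have e : ∑ i, ‖z i‖ ^ 2 = ((z 0).re ^ 2 + (z 1).re ^ 2 + (z 2).re ^ 2)
      + ((z 0).im ^ 2 + (z 1).im ^ 2 + (z 2).im ^ 2) := by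
    simp only [Fin.sum_univ_three, Complex.sq_norm, Complex.normSq_apply]
    ring
  rw [e, hermForm]
  constructor <;> linarith

theorem isBounded_frequency_le {n : ℕ} (k : ℝ) :
    Bornology.IsBounded {ξ : EuclideanSpace ℝ (Fin n) | 2 * π * ‖ξ‖ ≤ k} := by
  refine (Metric.isBounded_closedBall (x := 0) (r := k / (2 * π))).subset fun ξ hξ => ?_
  rw [mem_closedBall_zero_iff, le_div_iff₀ (by positivity), mul_comm]
  exact hξ

/-! ### Decay and persistence at almost every frequency. -/

namespace IsThermoPlateSolution

variable {n : ℕ} {σ : ℝ} {u₀ : 𝓢'(EuclideanSpace ℝ (Fin n), ℂ)} {u₁ θ₀ : L2 n}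
  {u : ℝ → 𝓢'(EuclideanSpace ℝ (Fin n), ℂ)} {w ut θ : ℝ → L2 n}

theorem low_frequency_le (hσ : 1 ≤ σ) (h : IsThermoPlateSolution σ u₀ u₁ θ₀ u w ut θ)
    {t : ℝ} (ht : 0 ≤ t) :
    ∀ᵐ ξ : EuclideanSpace ℝ (Fin n), 2 * π * ‖ξ‖ ≤ 1 → ξ ≠ 0 →
      ∑ i, ‖fourierState (w t) (ut t) (θ t) i ξ‖ ^ 2 ≤
        4 * Real.exp (-((2 * π * ‖ξ‖) ^ 2 / 400) * t) *
          ∑ i, ‖fourierState (w 0) (ut 0) (θ 0) i ξ‖ ^ 2 := by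
  -- A ρ-dependent rate is recovered from constant ones: rational r keep the exceptional null sets
  -- countable, and choosing ρ²/2 < r < ρ² costs a factor 2 in the exponent.
  have key : ∀ r : ℚ, ∀ᵐ ξ : EuclideanSpace ℝ (Fin n),
      ξ ∈ {ξ | 2 * π * ‖ξ‖ ≤ 1} ∩ {ξ | (r : ℝ) ≤ (2 * π * ‖ξ‖) ^ 2} →
      hermForm (lyapunovMatrix 1 (1 / 10) (1 / 40))
        (fun i => fourierState (w t) (ut t) (θ t) i ξ) ≤ Real.exp (-(r / 200) * t) *
      hermForm (lyapunovMatrix 1 (1 / 10) (1 / 40))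
        (fun i => fourierState (w 0) (ut 0) (θ 0) i ξ) := by
    intro r
    refine h.hermForm_le_exp_mul (by linarith)
      (S := fun i j _ => lyapunovMatrix 1 (1 / 10) (1 / 40) i j) ?_
      ((isBounded_frequency_le 1).subset Set.inter_subset_left) (fun _ _ => continuous_const)
      (fun ξ hξ v => ?_) ht
    · exact (measurableSet_le (by fun_prop) (by fun_prop)).inter
        (measurableSet_le (by fun_prop) (by fun_prop))
    · refine quadFormDeriv_le_of_low_frequency (by positivity) ?_ hξ.2 v
      rw [← Real.rpow_natCast]
      exact Real.rpow_le_rpow_of_exponent_ge_of_imp (by positivity) hξ.1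
        (by push_cast; linarith) (by intro _ h; linarith)
  filter_upwards [ae_all_iff.2 key] with ξ hξ h1 h0
  have hpos : 0 < (2 * π * ‖ξ‖) ^ 2 := by
    have := norm_pos_iff.2 h0
    positivity
  obtain ⟨r, hr1, hr2⟩ := exists_rat_btwn (half_lt_self hpos)
  have h2 := hξ r ⟨h1, hr2.le⟩
  have h3 := (hermForm_lyapunovMatrix_bounds (a := 1 / 10) (b := 1 / 40) (by norm_num)
    (by norm_num) (by norm_num) fun i => fourierState (w t) (ut t) (θ t) i ξ).1
  have h4 := (hermForm_lyapunovMatrix_bounds (a := 1 / 10) (b := 1 / 40) (by norm_num)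
    (by norm_num) (by norm_num) fun i => fourierState (w 0) (ut 0) (θ 0) i ξ).2
  have h5 : Real.exp (-(r / 200) * t) ≤ Real.exp (-((2 * π * ‖ξ‖) ^ 2 / 400) * t) :=
    Real.exp_le_exp.2 (mul_le_mul_of_nonneg_right (by linarith) ht)
  have h6 := mul_le_mul h5 h4 ((by positivity : (0:ℝ) ≤ _).trans
    (hermForm_lyapunovMatrix_bounds (a := 1 / 10) (b := 1 / 40) (by norm_num)
    (by norm_num) (by norm_num) _).1) (Real.exp_pos _).le
  linarith

theorem high_frequency_le (hσ : 1 ≤ σ ∧ σ ≤ 2)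
    (h : IsThermoPlateSolution σ u₀ u₁ θ₀ u w ut θ) {t : ℝ} (ht : 0 ≤ t) :
    ∀ᵐ ξ : EuclideanSpace ℝ (Fin n), 1 ≤ 2 * π * ‖ξ‖ →
      ∑ i, ‖fourierState (w t) (ut t) (θ t) i ξ‖ ^ 2 ≤
        4 * Real.exp (-(1 / 5) * t) *
          ∑ i, ‖fourierState (w 0) (ut 0) (θ 0) i ξ‖ ^ 2 := by
  -- This is the weight a/(4b) = ρ^(2-2σ)/4; the maximum with 1 keeps it continuous at ξ = 0, where
  -- the exponent is negative for σ > 1.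
  set d : EuclideanSpace ℝ (Fin n) → ℝ := fun ξ => (max (2 * π * ‖ξ‖) 1) ^ (2 - 2 * σ) / 4
    with hd
  have hdc : Continuous d := by
    refine ((by fun_prop : Continuous fun ξ : EuclideanSpace ℝ (Fin n) =>
      max (2 * π * ‖ξ‖) 1).rpow_const fun ξ => Or.inl ?_).div_const 4
    positivity
  -- The rate is uniform here, so only an exhaustion by bounded sets is needed.
  have key : ∀ k : ℕ, ∀ᵐ ξ : EuclideanSpace ℝ (Fin n),
      ξ ∈ {ξ | 2 * π * ‖ξ‖ ≤ k} ∩ {ξ | 1 ≤ 2 * π * ‖ξ‖} →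
      hermForm (fun i j => lyapunovMatrix 1 0 (d ξ) i j)
        (fun i => fourierState (w t) (ut t) (θ t) i ξ) ≤ Real.exp (-(1 / 5) * t) *
      hermForm (fun i j => lyapunovMatrix 1 0 (d ξ) i j)
        (fun i => fourierState (w 0) (ut 0) (θ 0) i ξ) := by
    intro k
    refine h.hermForm_le_exp_mul (by linarith) (S := fun i j ξ => lyapunovMatrix 1 0 (d ξ) i j) ?_
      ((isBounded_frequency_le k).subset Set.inter_subset_left) (fun i j => ?_)
      (fun ξ hξ v => ?_) ht
    · exact (measurableSet_le (by fun_prop) (by fun_prop)).inter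
        (measurableSet_le (by fun_prop) (by fun_prop))
    · fin_cases i <;> fin_cases j <;> simp [lyapunovMatrix] <;> fun_prop
    · have h1 : 1 ≤ 2 * π * ‖ξ‖ := hξ.2
      have h0 : 0 < 2 * π * ‖ξ‖ := by linarith
      have := quadFormDeriv_le_of_high_frequency (a := (2 * π * ‖ξ‖) ^ (2 - σ))
        (b := (2 * π * ‖ξ‖) ^ σ) (Real.one_le_rpow h1 (by linarith))
        (Real.rpow_le_rpow_of_exponent_le h1 (by linarith)) v
      rw [← Real.rpow_sub h0, ← Real.rpow_add h0, ← Real.rpow_natCast, ← Real.rpow_mul h0.le] at this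
      have e1 : 2 - σ - σ = 2 - 2 * σ := by ring
      have e2 : 2 - σ + σ = 2 := by ring
      have e3 : σ * ((2 : ℕ) : ℝ) = 2 * σ := by push_cast; ring
      rw [e1, e2, e3, Real.rpow_two] at this
      simpa only [hd, max_eq_left h1] using this
  filter_upwards [ae_all_iff.2 key] with ξ hξ h1
  obtain ⟨k, hk⟩ := exists_nat_ge (2 * π * ‖ξ‖)
  have h2 := hξ k ⟨hk, h1⟩
  have hd0 : 0 ≤ d ξ := by positivity
  have hd1 : 0 + d ξ ≤ 1 / 4 := by
    have : (max (2 * π * ‖ξ‖) 1) ^ (2 - 2 * σ) ≤ 1 :=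
      Real.rpow_le_one_of_one_le_of_nonpos (le_max_right _ _) (by linarith)
    simp only [hd]
    linarith
  have h3 := (hermForm_lyapunovMatrix_bounds le_rfl hd0 hd1
    fun i => fourierState (w t) (ut t) (θ t) i ξ).1
  have h4 := (hermForm_lyapunovMatrix_bounds le_rfl hd0 hd1
    fun i => fourierState (w 0) (ut 0) (θ 0) i ξ).2
  have h6 := mul_le_mul_of_nonneg_left h4 (Real.exp_pos (-(1 / 5) * t)).le
  linarith

theorem low_frequency_ge (hσ : 1 ≤ σ) (h : IsThermoPlateSolution σ u₀ u₁ θ₀ u w ut θ)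
    {t : ℝ} (ht : 0 ≤ t) :
    ∀ᵐ ξ : EuclideanSpace ℝ (Fin n), 2 * π * ‖ξ‖ ≤ 1 → ξ ≠ 0 →
      Real.exp (-(4 * (2 * π * ‖ξ‖) ^ 2) * t) *
          ∑ i, ‖fourierState (w 0) (ut 0) (θ 0) i ξ‖ ^ 2 ≤
        ∑ i, ‖fourierState (w t) (ut t) (θ t) i ξ‖ ^ 2 := by
  have key : ∀ r : ℚ, ∀ᵐ ξ : EuclideanSpace ℝ (Fin n),
      ξ ∈ {ξ | 2 * π * ‖ξ‖ ≤ 1} ∩ {ξ | (2 * π * ‖ξ‖) ^ 2 ≤ r} →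
      hermForm (lyapunovMatrix (-1) 0 0)
        (fun i => fourierState (w t) (ut t) (θ t) i ξ) ≤ Real.exp (-(2 * r) * t) *
      hermForm (lyapunovMatrix (-1) 0 0)
        (fun i => fourierState (w 0) (ut 0) (θ 0) i ξ) := by
    intro r
    refine h.hermForm_le_exp_mul (by linarith)
      (S := fun i j _ => lyapunovMatrix (-1) 0 0 i j) ?_
      ((isBounded_frequency_le 1).subset Set.inter_subset_left) (fun _ _ => continuous_const)
      (fun ξ hξ v => ?_) ht
    · exact (measurableSet_le (by fun_prop) (by fun_prop)).inter
        (measurableSet_le (by fun_prop) (by fun_prop))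
    · refine quadFormDeriv_neg_le (by positivity) ?_ hξ.2 v
      rw [← Real.rpow_natCast]
      exact Real.rpow_le_rpow_of_exponent_ge_of_imp (by positivity) hξ.1
        (by push_cast; linarith) (by intro _ h; linarith)
  filter_upwards [ae_all_iff.2 key] with ξ hξ h1 h0
  have hpos : 0 < (2 * π * ‖ξ‖) ^ 2 := by
    have := norm_pos_iff.2 h0
    positivity
  -- Now r must bound ρ² from above, so it is taken in (ρ², 2ρ²).
  obtain ⟨r, hr1, hr2⟩ := exists_rat_btwn (by linarith : (2 * π * ‖ξ‖) ^ 2 < 2 * (2 * π * ‖ξ‖) ^ 2)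
  have h2 := hξ r ⟨h1, hr1.le⟩
  rw [hermForm_lyapunovMatrix, hermForm_lyapunovMatrix] at h2
  have h5 : Real.exp (-(4 * (2 * π * ‖ξ‖) ^ 2) * t) ≤ Real.exp (-(2 * r) * t) :=
    Real.exp_le_exp.2 (mul_le_mul_of_nonneg_right (by linarith) ht)
  have h6 := mul_le_mul_of_nonneg_right h5
    (by positivity : 0 ≤ ∑ i, ‖fourierState (w 0) (ut 0) (θ 0) i ξ‖ ^ 2)
  linarith

end IsThermoPlateSolution

/-! ### Scaling of the frequency integrals. -/

/-- Raise y ≤ exp y, with y = bx/(s+1), to the power s. Using s + 1 in place of s covers s = 0. -/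
theorem Real.rpow_le_mul_exp {x s b : ℝ} (hx : 0 ≤ x) (hs : 0 ≤ s) (hb : 0 < b) :
    x ^ s ≤ ((s + 1) / b) ^ s * Real.exp (b * x) := by
  have hA : 0 < (s + 1) / b := by positivity
  have h1 : x ≤ (s + 1) / b * Real.exp (b / (s + 1) * x) := by
    have := Real.add_one_le_exp (b / (s + 1) * x)
    have h2 : x = (s + 1) / b * (b / (s + 1) * x) := by field_simp
    calc x = (s + 1) / b * (b / (s + 1) * x) := h2
      _ ≤ _ := mul_le_mul_of_nonneg_left (by linarith) hA.le
  calc x ^ s ≤ ((s + 1) / b * Real.exp (b / (s + 1) * x)) ^ s := Real.rpow_le_rpow hx h1 hs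
    _ = ((s + 1) / b) ^ s * Real.exp (b / (s + 1) * x * s) := by
      rw [Real.mul_rpow hA.le (Real.exp_pos _).le, ← Real.exp_mul]
    _ ≤ _ := by
      refine mul_le_mul_of_nonneg_left (Real.exp_le_exp.2 ?_) (by positivity)
      rw [show b / (s + 1) * x * s = b * x * (s / (s + 1)) by field_simp]
      exact mul_le_of_le_one_right (by positivity) ((div_le_one (by positivity)).2 (by linarith))

section Scaling

variable {n : ℕ}

theorem lintegral_comp_sqrt_smul {f : EuclideanSpace ℝ (Fin n) → ℝ≥0∞} (hf : Measurable f)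
    {t : ℝ} (ht : 0 < t) :
    ∫⁻ ξ, f (√t • ξ) = ENNReal.ofReal (t ^ (-(n : ℝ) / 2)) * ∫⁻ ξ, f ξ := by
  have h := Measure.map_addHaar_smul (volume : Measure (EuclideanSpace ℝ (Fin n)))
    (Real.sqrt_pos.2 ht).ne'
  rw [← lintegral_map (μ := volume) hf (measurable_const_smul (√t)), h, lintegral_smul_measure,
    smul_eq_mul]
  congr 2
  rw [finrank_euclideanSpace_fin, abs_of_nonneg (by positivity), Real.sqrt_eq_rpow,
    ← Real.rpow_natCast, ← Real.rpow_mul ht.le, ← Real.rpow_neg ht.le]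
  congr 1
  ring

theorem frequency_sqrt_smul_rpow {s t : ℝ} (ht : 0 < t) (ξ : EuclideanSpace ℝ (Fin n)) :
    (2 * π * ‖√t • ξ‖) ^ (2 * s) = t ^ s * (2 * π * ‖ξ‖) ^ (2 * s) := by
  rw [norm_smul, Real.norm_of_nonneg (Real.sqrt_nonneg t),
    show 2 * π * (√t * ‖ξ‖) = √t * (2 * π * ‖ξ‖) by ring,
    Real.mul_rpow (Real.sqrt_nonneg t) (by positivity), Real.sqrt_eq_rpow, ← Real.rpow_mul ht.le]
  congr 2
  ring

theorem frequency_sqrt_smul_sq {t : ℝ} (ht : 0 < t) (ξ : EuclideanSpace ℝ (Fin n)) :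
    (2 * π * ‖√t • ξ‖) ^ 2 = (2 * π * ‖ξ‖) ^ 2 * t := by
  rw [norm_smul, Real.norm_of_nonneg (Real.sqrt_nonneg t)]
  nlinarith [Real.sq_sqrt ht.le]

/-- Substituting √t ξ, the volume contributes t^(-n/2) and the weight t^(-s). Used with g an
exponential for the upper bound and the indicator of (-∞, 1] for the lower one. -/
theorem lintegral_frequency_rpow_mul {s : ℝ} {g : ℝ → ℝ} (hg : Measurable g) {t : ℝ}
    (ht : 0 < t) :
    ∫⁻ ξ : EuclideanSpace ℝ (Fin n),
      ENNReal.ofReal ((2 * π * ‖ξ‖) ^ (2 * s) * g ((2 * π * ‖ξ‖) ^ 2 * t)) =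
    ENNReal.ofReal (t ^ (-((n : ℝ) + 2 * s) / 2)) * ∫⁻ ξ : EuclideanSpace ℝ (Fin n),
      ENNReal.ofReal ((2 * π * ‖ξ‖) ^ (2 * s) * g ((2 * π * ‖ξ‖) ^ 2)) := by
  have hm : Measurable fun ξ : EuclideanSpace ℝ (Fin n) =>
      ENNReal.ofReal ((2 * π * ‖ξ‖) ^ (2 * s) * g ((2 * π * ‖ξ‖) ^ 2)) := by fun_prop
  have h := lintegral_comp_sqrt_smul hm ht
  have e0 : ∀ ξ : EuclideanSpace ℝ (Fin n), ENNReal.ofReal ((2 * π * ‖√t • ξ‖) ^ (2 * s) *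
      g ((2 * π * ‖√t • ξ‖) ^ 2)) = ENNReal.ofReal (t ^ s) *
      ENNReal.ofReal ((2 * π * ‖ξ‖) ^ (2 * s) * g ((2 * π * ‖ξ‖) ^ 2 * t)) := by
    intro ξ
    rw [frequency_sqrt_smul_rpow ht, frequency_sqrt_smul_sq ht, mul_assoc (t ^ s),
      ENNReal.ofReal_mul (Real.rpow_nonneg ht.le s)]
  simp only [e0] at h
  rw [lintegral_const_mul _ (by fun_prop)] at h
  have e : ENNReal.ofReal (t ^ (-((n : ℝ) + 2 * s) / 2)) =
      ENNReal.ofReal (t ^ (-s)) * ENNReal.ofReal (t ^ (-(n : ℝ) / 2)) := by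
    rw [← ENNReal.ofReal_mul (by positivity), ← Real.rpow_add ht]
    congr 2
    ring
  rw [e, mul_assoc, ← h, ← mul_assoc, ← ENNReal.ofReal_mul (by positivity), ← Real.rpow_add ht]
  simp

theorem lintegral_frequency_gaussian_ne_top {s b : ℝ} (hs : 0 ≤ s) (hb : 0 < b) :
    ∫⁻ ξ : EuclideanSpace ℝ (Fin n),
      ENNReal.ofReal ((2 * π * ‖ξ‖) ^ (2 * s) * Real.exp (-b * (2 * π * ‖ξ‖) ^ 2)) ≠ ∞ := by
  have hc : 0 < b / 2 * (2 * π) ^ 2 := by positivity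
  have hi : Integrable fun ξ : EuclideanSpace ℝ (Fin n) =>
      Real.exp (-(b / 2 * (2 * π) ^ 2) * ‖ξ‖ ^ 2) := by
    have := (GaussianFourier.integrable_cexp_neg_mul_sq_norm_add
      (b := ((b / 2 * (2 * π) ^ 2 : ℝ) : ℂ)) (by rw [Complex.ofReal_re]; exact hc) 0
      (0 : EuclideanSpace ℝ (Fin n))).re
    refine this.congr (.of_forall fun ξ => ?_)
    simp only [inner_zero_left]
    rw [← Complex.ofReal_re (Real.exp _)]
    push_cast
    simp
  refine ne_of_lt (lt_of_le_of_lt (lintegral_mono fun ξ => ENNReal.ofReal_le_ofReal ?_)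
    (hi.const_mul (((s + 1) / (b / 2)) ^ s)).lintegral_lt_top)
  have h0 : 0 ≤ 2 * π * ‖ξ‖ := by positivity
  have h := Real.rpow_le_mul_exp (sq_nonneg (2 * π * ‖ξ‖)) hs (half_pos hb)
  rw [← Real.rpow_natCast, ← Real.rpow_mul h0] at h
  calc _ ≤ ((s + 1) / (b / 2)) ^ s * Real.exp (b / 2 * (2 * π * ‖ξ‖) ^ 2)
        * Real.exp (-b * (2 * π * ‖ξ‖) ^ 2) := by
        refine mul_le_mul_of_nonneg_right ?_ (Real.exp_pos _).le
        simpa using h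
    _ = _ := by
      rw [mul_assoc, ← Real.exp_add]
      congr 2
      ring

theorem lintegral_frequency_ball_ne_zero (hn : 1 ≤ n) (s : ℝ) :
    ∫⁻ ξ : EuclideanSpace ℝ (Fin n), ENNReal.ofReal
      ((2 * π * ‖ξ‖) ^ (2 * s) * (Set.Iic (1 : ℝ)).indicator 1 ((2 * π * ‖ξ‖) ^ 2)) ≠ 0 := by
  have : Nonempty (Fin n) := ⟨⟨0, hn⟩⟩
  have hm : Measurable ((Set.Iic (1 : ℝ)).indicator (1 : ℝ → ℝ)) :=
    measurable_one.indicator measurableSet_Iic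
  intro h
  rw [lintegral_eq_zero_iff (by fun_prop)] at h
  have hne : ∀ᵐ ξ : EuclideanSpace ℝ (Fin n), ξ ≠ 0 := Measure.ae_ne volume 0
  have hball : volume (Metric.ball (0 : EuclideanSpace ℝ (Fin n)) (1 / (2 * π))) = 0 := by
    rw [measure_eq_zero_iff_ae_notMem]
    filter_upwards [h, hne] with ξ hξ h0 hmem
    have h1 : 0 < 2 * π * ‖ξ‖ := by have := norm_pos_iff.2 h0; positivity
    have h2 : 2 * π * ‖ξ‖ ≤ 1 := by
      rw [mem_ball_zero_iff, lt_div_iff₀ (by positivity)] at hmem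
      linarith
    have h3 : (2 * π * ‖ξ‖) ^ 2 ∈ Set.Iic (1 : ℝ) := pow_le_one₀ h1.le h2
    simp only [Pi.zero_apply, Set.indicator_of_mem h3, Pi.one_apply, mul_one,
      ENNReal.ofReal_eq_zero] at hξ
    linarith [Real.rpow_pos_of_pos h1 (2 * s)]
  exact (Metric.measure_ball_pos volume 0 (by positivity)).ne' hball

end Scaling

/-! ### Norms and the Fourier transform of the data. -/

section Norms

variable {n : ℕ}

theorem ofReal_sum_sq_norm (z : Fin 3 → ℂ) :
    ENNReal.ofReal (∑ i, ‖z i‖ ^ 2) = ∑ i, ‖z i‖ₑ ^ 2 := by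
  rw [ENNReal.ofReal_sum_of_nonneg fun i _ => by positivity]
  refine Finset.sum_congr rfl fun i _ => ?_
  rw [ENNReal.ofReal_pow (norm_nonneg _), ofReal_norm]

theorem homSobolevNorm_eq (s : ℝ) (U : Fin 3 → L2 n) :
    homSobolevNorm s U = (∫⁻ ξ, ENNReal.ofReal ((2 * π * ‖ξ‖) ^ (2 * s)) *
      ∑ j, ‖(𝓕 (U j) : L2 n) ξ‖ₑ ^ 2) ^ (1 / 2 : ℝ) := by
  simp only [homSobolevNorm, Finset.mul_sum]
  rw [lintegral_finsetSum' _ fun j _ => ?_]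
  have := Lp.aestronglyMeasurable (𝓕 (U j) : L2 n)
  fun_prop

theorem sobolevNorm_eq (s : ℝ) (U : Fin 3 → L2 n) :
    sobolevNorm s U = (∫⁻ ξ, ENNReal.ofReal ((1 + (2 * π * ‖ξ‖) ^ 2) ^ s) *
      ∑ j, ‖(𝓕 (U j) : L2 n) ξ‖ₑ ^ 2) ^ (1 / 2 : ℝ) := by
  simp only [sobolevNorm, Finset.mul_sum]
  rw [lintegral_finsetSum' _ fun j _ => ?_]
  have := Lp.aestronglyMeasurable (𝓕 (U j) : L2 n)
  fun_prop

theorem sum_sq_fourier_stateVector (w v θ : L2 n) :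
    ∀ᵐ ξ, ∑ i, ‖fourierState w v θ i ξ‖ ^ 2 ≤ ∑ j, ‖(𝓕 (stateVector w v θ j) : L2 n) ξ‖ ^ 2 ∧
      ∑ j, ‖(𝓕 (stateVector w v θ j) : L2 n) ξ‖ ^ 2 ≤
        2 * ∑ i, ‖fourierState w v θ i ξ‖ ^ 2 := by
  have e1 : (𝓕 (v + w) : L2 n) = 𝓕 v + 𝓕 w := (Lp.fourierTransformₗᵢ _ ℂ).map_add v w
  have e2 : (𝓕 (v - w) : L2 n) = 𝓕 v - 𝓕 w := (Lp.fourierTransformₗᵢ _ ℂ).map_sub v w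
  filter_upwards [Lp.coeFn_add (𝓕 v : L2 n) (𝓕 w), Lp.coeFn_sub (𝓕 v : L2 n) (𝓕 w)]
    with ξ h1 h2
  have e : ∑ j, ‖(𝓕 (stateVector w v θ j) : L2 n) ξ‖ ^ 2 =
      2 * ‖(𝓕 v : L2 n) ξ‖ ^ 2 + 2 * ‖(𝓕 w : L2 n) ξ‖ ^ 2 + ‖(𝓕 θ : L2 n) ξ‖ ^ 2 := by
    simp only [Fin.sum_univ_three, stateVector, Matrix.cons_val, e1, e2, h1, h2, Pi.add_apply,
      Pi.sub_apply]
    have := parallelogram_law_with_norm ℝ ((𝓕 v : L2 n) ξ) ((𝓕 w : L2 n) ξ)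
    nlinarith
  rw [e]
  simp only [Fin.sum_univ_three, fourierState, Matrix.cons_val]
  constructor <;> nlinarith [sq_nonneg ‖(𝓕 v : L2 n) ξ‖, sq_nonneg ‖(𝓕 w : L2 n) ξ‖,
    sq_nonneg ‖(𝓕 θ : L2 n) ξ‖]

theorem MemSobolevInterWeightedL1.integrable {s : ℝ} {U : Fin 3 → L2 n}
    (hU : MemSobolevInterWeightedL1 s U) (j : Fin 3) : Integrable (U j) := by
  refine (hU j).2.mono (Lp.aestronglyMeasurable _) (.of_forall fun x => ?_)
  rw [norm_smul, Real.norm_of_nonneg (by positivity)]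
  exact le_mul_of_one_le_left (norm_nonneg _) (by simp)

theorem sum_sq_fourier_le_weightedL1Norm {U : Fin 3 → L2 n} (hU : ∀ j, Integrable (U j)) :
    ∀ᵐ ξ, ∑ j, ‖(𝓕 (U j) : L2 n) ξ‖ₑ ^ 2 ≤ weightedL1Norm U ^ 2 := by
  filter_upwards [ae_all_iff.2 fun j => L2.fourier_eq_integral (U j) (hU j)] with ξ hξ
  have h1 : ∀ j, ‖(𝓕 (U j) : L2 n) ξ‖ₑ ≤
      ∫⁻ x : EuclideanSpace ℝ (Fin n), ENNReal.ofReal (1 + ‖x‖) * ‖U j x‖ₑ := by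
    intro j
    rw [hξ j]
    calc ‖𝓕 (U j : EuclideanSpace ℝ (Fin n) → ℂ) ξ‖ₑ
        ≤ ∫⁻ x, ‖𝐞 (-inner ℝ x ξ) • U j x‖ₑ := by
          rw [Real.fourier_eq]; exact enorm_integral_le_lintegral_enorm _
      _ ≤ _ := by
          refine lintegral_mono fun x => ?_
          have : ‖𝐞 (-inner ℝ x ξ) • U j x‖ₑ = ‖U j x‖ₑ := by
            rw [← ofReal_norm, ← ofReal_norm, Circle.norm_smul]
          rw [this]
          refine le_mul_of_one_le_left zero_le ?_
          rw [← ENNReal.ofReal_one]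
          exact ENNReal.ofReal_le_ofReal (by simp)
  calc ∑ j, ‖(𝓕 (U j) : L2 n) ξ‖ₑ ^ 2
      ≤ ∑ j, (∫⁻ x : EuclideanSpace ℝ (Fin n), ENNReal.ofReal (1 + ‖x‖) * ‖U j x‖ₑ)
          * weightedL1Norm U := by
        refine Finset.sum_le_sum fun j _ => ?_
        rw [sq]
        refine mul_le_mul' (h1 j) ((h1 j).trans ?_)
        exact Finset.single_le_sum
          (f := fun j => ∫⁻ x : EuclideanSpace ℝ (Fin n), ENNReal.ofReal (1 + ‖x‖) * ‖U j x‖ₑ)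
          (fun _ _ => zero_le) (Finset.mem_univ j)
    _ = _ := by rw [← Finset.sum_mul, sq]; rfl

/-- The transform of an integrable function is continuous and its value at 0 is the mean. The radius
δ depends on the data, which is why T does too. -/
theorem exists_sum_sq_fourier_ge {U : Fin 3 → L2 n} (hU : ∀ j, Integrable (U j))
    (hP : totalIntegral U ≠ 0) :
    ∃ δ : ℝ, 0 < δ ∧ ∀ᵐ ξ : EuclideanSpace ℝ (Fin n), ‖ξ‖ < δ →
      ‖totalIntegral U‖ ^ 2 / 2 ≤ ∑ j, ‖(𝓕 (U j) : L2 n) ξ‖ ^ 2 := by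
  have hc : Continuous fun ξ => ∑ j, ‖𝓕 (U j : EuclideanSpace ℝ (Fin n) → ℂ) ξ‖ ^ 2 :=
    continuous_finsetSum _ fun j _ => (VectorFourier.fourierIntegral_continuous
      Real.continuous_fourierChar (by exact continuous_inner) (hU j)).norm.pow 2
  have h0 : ∑ j, ‖𝓕 (U j : EuclideanSpace ℝ (Fin n) → ℂ) 0‖ ^ 2 = ‖totalIntegral U‖ ^ 2 := by
    rw [EuclideanSpace.norm_sq_eq]
    simp [totalIntegral, Real.fourier_eq]
  have hpos : 0 < ‖totalIntegral U‖ ^ 2 := by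
    have := norm_pos_iff.2 hP
    positivity
  have hev := hc.continuousAt.eventually (lt_mem_nhds
    (show ‖totalIntegral U‖ ^ 2 / 2 <
      ∑ j, ‖𝓕 (U j : EuclideanSpace ℝ (Fin n) → ℂ) 0‖ ^ 2 by rw [h0]; linarith))
  obtain ⟨δ, hδ, hball⟩ := Metric.eventually_nhds_iff.1 hev
  refine ⟨δ, hδ, ?_⟩
  filter_upwards [ae_all_iff.2 fun j => L2.fourier_eq_integral (U j) (hU j)] with ξ hξ hlt
  simp only [hξ]
  exact (hball (by simpa using hlt)).le

end Norms

/-! ### The two bounds for the homogeneous norm. -/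

namespace IsThermoPlateSolution

variable {n : ℕ} {σ : ℝ} {u₀ : 𝓢'(EuclideanSpace ℝ (Fin n), ℂ)} {u₁ θ₀ : L2 n}
  {u : ℝ → 𝓢'(EuclideanSpace ℝ (Fin n), ℂ)} {w ut θ : ℝ → L2 n}

theorem homSobolevNorm_le (hn : 1 ≤ n) (hσ : 1 ≤ σ ∧ σ ≤ 2) {s : ℝ} (hs : 0 ≤ s)
    (h : IsThermoPlateSolution σ u₀ u₁ θ₀ u w ut θ)
    (hU : ∀ j, Integrable (stateVector (w 0) (ut 0) (θ 0) j)) {t : ℝ} (ht : 0 < t) :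
    homSobolevNorm s (stateVector (w t) (ut t) (θ t)) ≤
      (ENNReal.ofReal (8 * t ^ (-((n : ℝ) + 2 * s) / 2)) *
        (∫⁻ ξ : EuclideanSpace ℝ (Fin n), ENNReal.ofReal ((2 * π * ‖ξ‖) ^ (2 * s) *
          Real.exp (-(1 / 400) * (2 * π * ‖ξ‖) ^ 2))) *
        weightedL1Norm (stateVector (w 0) (ut 0) (θ 0)) ^ 2 +
      ENNReal.ofReal (8 * Real.exp (-(1 / 5) * t)) *
        sobolevNorm s (stateVector (w 0) (ut 0) (θ 0)) ^ 2) ^ (1 / 2 : ℝ) := by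
  have : Nonempty (Fin n) := ⟨⟨0, hn⟩⟩
  have hsob : sobolevNorm s (stateVector (w 0) (ut 0) (θ 0)) ^ 2 =
      ∫⁻ ξ, ENNReal.ofReal ((1 + (2 * π * ‖ξ‖) ^ 2) ^ s) *
      ∑ j, ‖(𝓕 (stateVector (w 0) (ut 0) (θ 0) j) : L2 n) ξ‖ₑ ^ 2 := by
    rw [sobolevNorm_eq, ← ENNReal.rpow_natCast, ← ENNReal.rpow_mul]
    norm_num
  have hscale := lintegral_frequency_rpow_mul (n := n) (s := s)
    (g := fun x => Real.exp (-(1 / 400) * x)) (by fun_prop) ht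
  rw [homSobolevNorm_eq, hsob, ENNReal.ofReal_mul (by norm_num), mul_assoc (ENNReal.ofReal 8),
    ← hscale]
  refine ENNReal.rpow_le_rpow ?_ (by norm_num)
  have hne : ∀ᵐ ξ : EuclideanSpace ℝ (Fin n), ξ ≠ 0 := Measure.ae_ne volume 0
  set W := weightedL1Norm (stateVector (w 0) (ut 0) (θ 0)) with hW
  calc _ ≤ ∫⁻ ξ : EuclideanSpace ℝ (Fin n), (ENNReal.ofReal 8 *
        ENNReal.ofReal ((2 * π * ‖ξ‖) ^ (2 * s) *
          Real.exp (-(1 / 400) * ((2 * π * ‖ξ‖) ^ 2 * t))) * W ^ 2 +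
        ENNReal.ofReal (8 * Real.exp (-(1 / 5) * t)) *
          (ENNReal.ofReal ((1 + (2 * π * ‖ξ‖) ^ 2) ^ s) *
          ∑ j, ‖(𝓕 (stateVector (w 0) (ut 0) (θ 0) j) : L2 n) ξ‖ₑ ^ 2)) := by
        refine lintegral_mono_ae ?_
        filter_upwards [hne, h.low_frequency_le hσ.1 ht.le, h.high_frequency_le hσ ht.le,
          sum_sq_fourier_stateVector (w t) (ut t) (θ t),
          sum_sq_fourier_stateVector (w 0) (ut 0) (θ 0),
          sum_sq_fourier_le_weightedL1Norm hU] with ξ h0 hlow hhigh ht' h0' hWξ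
        have hρ : 0 ≤ 2 * π * ‖ξ‖ := by positivity
        -- Low frequencies use the L¹ bound, high ones the Hˢ norm. The constant 8 is the 4 of the
        -- pointwise estimates times the 2 from passing between z and U.
        rcases le_total (2 * π * ‖ξ‖) 1 with h1 | h1
        · refine le_trans ?_ (le_add_of_nonneg_right zero_le)
          calc _ ≤ ENNReal.ofReal ((2 * π * ‖ξ‖) ^ (2 * s)) *
                (ENNReal.ofReal (8 * Real.exp (-(1 / 400) * ((2 * π * ‖ξ‖) ^ 2 * t))) *
                ∑ j, ‖(𝓕 (stateVector (w 0) (ut 0) (θ 0) j) : L2 n) ξ‖ₑ ^ 2) := by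
                gcongr
                rw [← ofReal_sum_sq_norm, ← ofReal_sum_sq_norm,
                  ← ENNReal.ofReal_mul (by positivity)]
                refine ENNReal.ofReal_le_ofReal ?_
                have e : -((2 * π * ‖ξ‖) ^ 2 / 400) * t =
                  -(1 / 400) * ((2 * π * ‖ξ‖) ^ 2 * t) := by ring
                have h3 := hlow h1 h0
                rw [e] at h3
                have h4 := mul_le_mul_of_nonneg_left h0'.1
                  (Real.exp_pos (-(1 / 400) * ((2 * π * ‖ξ‖) ^ 2 * t))).le
                linarith [ht'.2]
            _ ≤ ENNReal.ofReal ((2 * π * ‖ξ‖) ^ (2 * s)) *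
                (ENNReal.ofReal (8 * Real.exp (-(1 / 400) * ((2 * π * ‖ξ‖) ^ 2 * t))) *
                W ^ 2) := by gcongr
            _ = _ := by
                rw [ENNReal.ofReal_mul (by norm_num : (0 : ℝ) ≤ 8),
                  ENNReal.ofReal_mul (by positivity)]
                ring
        · refine le_trans ?_ (le_add_of_nonneg_left zero_le)
          calc _ ≤ ENNReal.ofReal ((1 + (2 * π * ‖ξ‖) ^ 2) ^ s) *
                (ENNReal.ofReal (8 * Real.exp (-(1 / 5) * t)) *
                ∑ j, ‖(𝓕 (stateVector (w 0) (ut 0) (θ 0) j) : L2 n) ξ‖ₑ ^ 2) := by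
                refine mul_le_mul' (ENNReal.ofReal_le_ofReal ?_) ?_
                · rw [Real.rpow_mul hρ, Real.rpow_two]
                  exact Real.rpow_le_rpow (by positivity) (by linarith) hs
                · rw [← ofReal_sum_sq_norm, ← ofReal_sum_sq_norm,
                    ← ENNReal.ofReal_mul (by positivity)]
                  refine ENNReal.ofReal_le_ofReal ?_
                  have h4 := mul_le_mul_of_nonneg_left h0'.1 (Real.exp_pos (-(1 / 5) * t)).le
                  linarith [ht'.2, hhigh h1]
            _ = _ := by ring
    _ = _ := by
        have hm := fun j => Lp.aestronglyMeasurable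
          (𝓕 (stateVector (w 0) (ut 0) (θ 0) j) : L2 n)
        rw [lintegral_add_left' (by fun_prop), lintegral_mul_const _ (by fun_prop),
          lintegral_const_mul _ (by fun_prop), lintegral_const_mul' _ _ ENNReal.ofReal_ne_top]

theorem le_homSobolevNorm (hn : 1 ≤ n) (hσ : 1 ≤ σ) {s : ℝ}
    (h : IsThermoPlateSolution σ u₀ u₁ θ₀ u w ut θ)
    (hU : ∀ j, Integrable (stateVector (w 0) (ut 0) (θ 0) j))
    (hP : totalIntegral (stateVector (w 0) (ut 0) (θ 0)) ≠ 0) :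
    ∃ T : ℝ, 1 ≤ T ∧ ∀ t, T ≤ t →
      (ENNReal.ofReal (Real.exp (-4) / 4 *
        ‖totalIntegral (stateVector (w 0) (ut 0) (θ 0))‖ ^ 2 * t ^ (-((n : ℝ) + 2 * s) / 2)) *
        ∫⁻ ξ : EuclideanSpace ℝ (Fin n), ENNReal.ofReal ((2 * π * ‖ξ‖) ^ (2 * s) *
          (Set.Iic (1 : ℝ)).indicator 1 ((2 * π * ‖ξ‖) ^ 2))) ^ (1 / 2 : ℝ) ≤
      homSobolevNorm s (stateVector (w t) (ut t) (θ t)) := by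
  have : Nonempty (Fin n) := ⟨⟨0, hn⟩⟩
  obtain ⟨δ, hδ, hge⟩ := exists_sum_sq_fourier_ge hU hP
  set P := ‖totalIntegral (stateVector (w 0) (ut 0) (θ 0))‖ with hPdef
  -- For t ≥ 1 + 1/δ² the ball ρ²t ≤ 1 lies in both ρ ≤ 1 and |ξ| < δ. On it the decay factor is at
  -- least exp(-4); the 1/4 combines the half in |P|²/2 with the 2 from passing between U and z.
  refine ⟨1 + 1 / δ ^ 2, by simp; positivity, fun t ht => ?_⟩
  have ht1 : 1 ≤ t := le_trans (by simp; positivity) ht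
  have ht0 : 0 < t := by linarith
  have hm : Measurable ((Set.Iic (1 : ℝ)).indicator (1 : ℝ → ℝ)) :=
    measurable_one.indicator measurableSet_Iic
  have hscale := lintegral_frequency_rpow_mul (n := n) (s := s) hm ht0
  rw [ENNReal.ofReal_mul (by positivity), mul_assoc, ← hscale, homSobolevNorm_eq,
    ← lintegral_const_mul' _ _ ENNReal.ofReal_ne_top]
  refine ENNReal.rpow_le_rpow (lintegral_mono_ae ?_) (by norm_num)
  have hne : ∀ᵐ ξ : EuclideanSpace ℝ (Fin n), ξ ≠ 0 := Measure.ae_ne volume 0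
  filter_upwards [hne, h.low_frequency_ge hσ ht0.le, hge,
    sum_sq_fourier_stateVector (w t) (ut t) (θ t),
    sum_sq_fourier_stateVector (w 0) (ut 0) (θ 0)] with ξ h0 hlow hgeξ ht' h0'
  by_cases hmem : (2 * π * ‖ξ‖) ^ 2 * t ∈ Set.Iic (1 : ℝ)
  · have hmem' : (2 * π * ‖ξ‖) ^ 2 * t ≤ 1 := hmem
    rw [Set.indicator_of_mem hmem, Pi.one_apply, mul_one, mul_comm]
    gcongr
    rw [← ofReal_sum_sq_norm]
    refine ENNReal.ofReal_le_ofReal ?_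
    have hρ : 2 * π * ‖ξ‖ ≤ 1 := by
      refine (pow_le_one_iff_of_nonneg (by positivity) two_ne_zero).1 ?_
      exact (le_mul_of_one_le_right (sq_nonneg _) ht1).trans hmem'
    have hξδ : ‖ξ‖ < δ := by
      by_contra! hle
      have h1 : ‖ξ‖ ≤ 2 * π * ‖ξ‖ :=
        le_mul_of_one_le_left (norm_nonneg _) (by linarith [Real.pi_gt_three])
      have h2 : δ ^ 2 ≤ (2 * π * ‖ξ‖) ^ 2 := pow_le_pow_left₀ hδ.le (hle.trans h1) 2
      have h3 : δ ^ 2 * (1 + 1 / δ ^ 2) ≤ 1 :=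
        (mul_le_mul h2 ht (by positivity) (sq_nonneg _)).trans hmem'
      have h4 : δ ^ 2 * (1 + 1 / δ ^ 2) = δ ^ 2 + 1 := by field_simp
      linarith [pow_pos hδ 2]
    have h1 := hlow hρ h0
    have h2 := hgeξ hξδ
    have h3 : Real.exp (-4) ≤ Real.exp (-(4 * (2 * π * ‖ξ‖) ^ 2) * t) :=
      Real.exp_le_exp.2 (by linarith)
    have h4 := mul_le_mul h3 (show P ^ 2 / 4 ≤
      ∑ i, ‖fourierState (w 0) (ut 0) (θ 0) i ξ‖ ^ 2 by linarith [h0'.2]) (by positivity)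
      (Real.exp_pos _).le
    linarith [ht'.1]
  · simp [Set.indicator_of_notMem hmem]

end IsThermoPlateSolution

/-! ### Choice of the constants. -/

theorem mainTheorem2 (n : ℕ) (hn : 1 ≤ n) (σ s : ℝ) (hσ : 1 < σ ∧ σ ≤ 2) (hs : 0 ≤ s) :
    ∃ c C t₀ : ℝ, 0 < c ∧ 0 < C ∧ 0 < t₀ ∧
      ∀ (u₀ : 𝓢'(EuclideanSpace ℝ (Fin n), ℂ)) (w₀ u₁ θ₀ : L2 n)
        (u : ℝ → 𝓢'(EuclideanSpace ℝ (Fin n), ℂ)) (w ut θ : ℝ → L2 n),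
        w₀.dist = -Δ u₀ →
        MemSobolevInterWeightedL1 s (stateVector w₀ u₁ θ₀) →
        totalIntegral (stateVector w₀ u₁ θ₀) ≠ 0 →
        IsThermoPlateSolution σ u₀ u₁ θ₀ u w ut θ →
        (∀ t, t₀ ≤ t →
          homSobolevNorm s (stateVector (w t) (ut t) (θ t)) ≤
            ENNReal.ofReal (C * t ^ (-((n : ℝ) + 2 * s) / 4)) *
              (sobolevNorm s (stateVector w₀ u₁ θ₀)
                + weightedL1Norm (stateVector w₀ u₁ θ₀))) ∧
        ∃ T, t₀ ≤ T ∧ ∀ t, T ≤ t →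
          ENNReal.ofReal (c * t ^ (-((n : ℝ) + 2 * s) / 4)
              * ‖totalIntegral (stateVector w₀ u₁ θ₀)‖) ≤
            homSobolevNorm s (stateVector (w t) (ut t) (θ t)) := by
  set a : ℝ := ((n : ℝ) + 2 * s) / 2 with ha_def
  have ha : 0 ≤ a := by positivity
  have ea : -((n : ℝ) + 2 * s) / 2 = -a := by rw [ha_def]; ring
  have ea' : -((n : ℝ) + 2 * s) / 4 = -a / 2 := by rw [ha_def]; ring
  rw [ea']
  have hsq : ∀ t : ℝ, 0 < t → (t ^ (-a / 2)) ^ 2 = t ^ (-a) := by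
    intro t ht
    rw [← Real.rpow_natCast, ← Real.rpow_mul ht.le]
    congr 1
    push_cast
    ring
  have hroot : ∀ x : ℝ≥0∞, (x ^ 2) ^ (1 / 2 : ℝ) = x := by
    intro x
    rw [← ENNReal.rpow_natCast, ← ENNReal.rpow_mul]
    norm_num
  set G := ∫⁻ ξ : EuclideanSpace ℝ (Fin n), ENNReal.ofReal ((2 * π * ‖ξ‖) ^ (2 * s) *
    Real.exp (-(1 / 400) * (2 * π * ‖ξ‖) ^ 2)) with hG
  have hGtop : G ≠ ∞ := lintegral_frequency_gaussian_ne_top hs (by norm_num)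
  set H := ∫⁻ ξ : EuclideanSpace ℝ (Fin n), ENNReal.ofReal ((2 * π * ‖ξ‖) ^ (2 * s) *
    (Set.Iic (1 : ℝ)).indicator 1 ((2 * π * ‖ξ‖) ^ 2)) with hH
  have hH0 : H ≠ 0 := lintegral_frequency_ball_ne_zero hn s
  have hmin : min H 1 ≠ ∞ := ne_top_of_le_ne_top ENNReal.one_ne_top (min_le_right _ _)
  -- Truncating at 1 gives a positive real below H without having to know that H is finite.
  set η := (min H 1).toReal with hη
  have hη0 : 0 < η :=
    ENNReal.toReal_pos (lt_min (pos_iff_ne_zero.2 hH0) one_pos).ne' hmin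
  have hηH : ENNReal.ofReal η ≤ H := by
    rw [hη, ENNReal.ofReal_toReal hmin]
    exact min_le_left _ _
  set A : ℝ := ((a + 1) / (1 / 5)) ^ a with hA
  have hA0 : 0 < A := by positivity
  -- The exponentially small high-frequency part is absorbed into the polynomial rate.
  have hexp : ∀ t : ℝ, 0 < t → Real.exp (-(1 / 5) * t) ≤ A * t ^ (-a) := by
    intro t ht
    have h1 := Real.rpow_le_mul_exp ht.le ha (by norm_num : (0 : ℝ) < 1 / 5)
    rw [Real.rpow_neg ht.le, ← div_eq_mul_inv, le_div_iff₀ (by positivity)]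
    calc Real.exp (-(1 / 5) * t) * t ^ a
        ≤ Real.exp (-(1 / 5) * t) * (A * Real.exp (1 / 5 * t)) :=
          mul_le_mul_of_nonneg_left h1 (Real.exp_pos _).le
      _ = A * Real.exp (-(1 / 5) * t + 1 / 5 * t) := by rw [Real.exp_add]; ring
      _ = A := by simp
  set K : ℝ := 8 * G.toReal + 8 * A with hK
  have hK0 : 0 < K := by positivity
  refine ⟨√(Real.exp (-4) / 4 * η), √K, 1, by positivity, by positivity, one_pos, ?_⟩
  intro u₀ w₀ u₁ θ₀ u w ut θ hw₀ hmem hP h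
  have hinit : stateVector w₀ u₁ θ₀ = stateVector (w 0) (ut 0) (θ 0) := by
    rw [h.w_init hw₀, h.ut_init, h.θ_init]
  have hU := hmem.integrable
  rw [hinit] at hU hP ⊢
  constructor
  · intro t ht
    have ht0 : 0 < t := by linarith
    set W := weightedL1Norm (stateVector (w 0) (ut 0) (θ 0))
    set S := sobolevNorm s (stateVector (w 0) (ut 0) (θ 0))
    refine (h.homSobolevNorm_le hn ⟨hσ.1.le, hσ.2⟩ hs hU ht0).trans ?_
    rw [← hroot (ENNReal.ofReal (√K * t ^ (-a / 2)) * (S + W))]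
    refine ENNReal.rpow_le_rpow ?_ (by norm_num)
    rw [mul_pow, ← ENNReal.ofReal_pow (by positivity), mul_pow, Real.sq_sqrt hK0.le, hsq t ht0,
      ea, ← hG]
    have h1 : ENNReal.ofReal (8 * t ^ (-a)) * G ≤ ENNReal.ofReal (K * t ^ (-a)) := by
      rw [← ENNReal.ofReal_toReal hGtop, ← ENNReal.ofReal_mul (by positivity)]
      refine ENNReal.ofReal_le_ofReal ?_
      have := mul_pos hA0 (Real.rpow_pos_of_pos ht0 (-a))
      rw [hK]
      linarith
    have h2 : ENNReal.ofReal (8 * Real.exp (-(1 / 5) * t)) ≤ ENNReal.ofReal (K * t ^ (-a)) := by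
      refine ENNReal.ofReal_le_ofReal ?_
      have := mul_nonneg (ENNReal.toReal_nonneg (a := G)) (Real.rpow_pos_of_pos ht0 (-a)).le
      rw [hK]
      linarith [hexp t ht0]
    calc _ ≤ ENNReal.ofReal (K * t ^ (-a)) * W ^ 2 + ENNReal.ofReal (K * t ^ (-a)) * S ^ 2 := by
          gcongr
      _ = ENNReal.ofReal (K * t ^ (-a)) * (S ^ 2 + W ^ 2) := by ring
      _ ≤ _ := by
          gcongr
          rw [add_sq]
          gcongr
          exact le_self_add
  · obtain ⟨T, hT1, hT⟩ := h.le_homSobolevNorm hn hσ.1.le (s := s) hU hP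
    refine ⟨T, hT1, fun t ht => le_trans ?_ (hT t ht)⟩
    have ht0 : 0 < t := by linarith
    rw [← hroot (ENNReal.ofReal _)]
    refine ENNReal.rpow_le_rpow ?_ (by norm_num)
    rw [← ENNReal.ofReal_pow (by positivity), mul_pow, mul_pow, Real.sq_sqrt (by positivity),
      hsq t ht0, ea]
    refine le_trans ?_ (mul_le_mul_right hηH _)
    rw [← ENNReal.ofReal_mul (by positivity)]
    exact ENNReal.ofReal_le_ofReal (le_of_eq (by ring))
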